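/- Let $G$ be a four-dimensional real Lie group with a left-invariant pseudo-Riemannian metric $g$, Levi-Civita connection $\nabla$ and Ricci operator $\mathrm{Ric}$. Let $\mathfrak{J}_+,\mathfrak{J}_-$ be left-invariant $(1,1)$-tensor fields on $G$ such that $(g,\mathfrak J_\pm)$ are almost para-Kähler structures, i.e. $\mathfrak{J}_\pm^2=\mathrm{id}$, $g(\mathfrak{J}_\pm X,\mathfrak{J}_\pm Y)=-g(X,Y)$, and the $2$-forms $\Omega_\pm(X,Y)=g(\mathfrak{J}_\pm X,Y)$ are closed. Assume that $(\Omega_+,\Omega_-)$ is a symplectic pair, i.e. $\Omega_\pm$ are symplectic, $\Omega_+\wedge\Omega_-=0$ and $\Omega_+\wedge\Omega_+=-\Omega_-\wedge\Omega_-$; that $\nabla\Omega_-=0$; and that the Ricci operator is $\mathfrak{J}_+$-invariant, i.e. $\mathrm{Ric}\,\mathfrak{J}_+=\mathfrak{J}_+\,\mathrm{Ric}$. Orient $G$ so that $\Omega_+$ is self-dual, let $W$ be the Weyl curvature operator on $2$-forms, $\star$ the Hodge star, and $W^\pm=\frac12(W\pm\star W)$ the self-dual and anti-self-dual Weyl curvature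 operators. Then exactly one of the following holds: (i) $W^+$ and $W^-$ are both diagonalizable (over $\mathbb{R}$); (ii) the minimal polynomial of $W^+$ has a non-zero (real) double root; (iii) the metric is self-dual ($W^-=0$) and non-flat, and $W^+$ is two-step nilpotent ($W^+\neq 0$, $(W^+)^2=0$). -/

import Mathlib

open scoped Manifold ContDiff

noncomputable section

namespace ParaLie

/-! ### Left-invariant tensor fields on a four-dimensional Lie group -/

section LieGroup

variable (G : Type*) [TopologicalSpace G] [ChartedSpace (EuclideanSpace ℝ (Fin 4)) G] [Group G]

/-- A smooth real Lie group has the smoothness that Mathlib requires for the bracket of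
left-invariant vector fields. -/
instance instLieGroupMinSmoothness [LieGroup (𝓡 4) ∞ G] :
    LieGroup (𝓡 4) (minSmoothness ℝ 3) G :=
  LieGroup.of_le (n := ∞) (by
    rw [minSmoothness_of_isRCLikeNormedField]; exact ENat.LEInfty.out)

/-- The Lie algebra of left-invariant vector fields, realised on the tangent space at `1`. -/
abbrev LieAlg : Type := GroupLieAlgebra (𝓡 4) G

instance instFiniteDimensionalLieAlg : FiniteDimensional ℝ (LieAlg G) :=
  inferInstanceAs (FiniteDimensional ℝ (EuclideanSpace ℝ (Fin 4)))

end LieGroup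

/-- A pseudo-Riemannian scalar product of arbitrary signature on a real vector space. -/
structure ScalarProduct (V : Type*) [AddCommGroup V] [Module ℝ V] where
  form : LinearMap.BilinForm ℝ V
  symm : ∀ x y, form x y = form y x
  nondegenerate : form.Nondegenerate

/-- A left-invariant pseudo-Riemannian metric on `G`: a field of scalar products on the tangent
spaces for which all left translations are isometries (such a field is automatically smooth). -/
structure LeftInvariantMetric (G : Type*) [TopologicalSpace G]
    [ChartedSpace (EuclideanSpace ℝ (Fin 4)) G] [Group G] where
  metric : ∀ p : G, ScalarProduct (TangentSpace (𝓡 4) p)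
  left_invariant : ∀ (a p : G) (v w : TangentSpace (𝓡 4) p),
    (metric (a * p)).form (mfderiv (𝓡 4) (𝓡 4) (fun q : G => a * q) p v)
      (mfderiv (𝓡 4) (𝓡 4) (fun q : G => a * q) p w) = (metric p).form v w

/-- A left-invariant field of endomorphisms of the tangent spaces of `G`. -/
structure LeftInvariantEndo (G : Type*) [TopologicalSpace G]
    [ChartedSpace (EuclideanSpace ℝ (Fin 4)) G] [Group G] where
  endo : ∀ p : G, TangentSpace (𝓡 4) p →ₗ[ℝ] TangentSpace (𝓡 4) p
  left_invariant : ∀ (a p : G) (v : TangentSpace (𝓡 4) p),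
    endo (a * p) (mfderiv (𝓡 4) (𝓡 4) (fun q : G => a * q) p v) =
      mfderiv (𝓡 4) (𝓡 4) (fun q : G => a * q) p (endo p v)

/-- The scalar product that a left-invariant metric induces on the Lie algebra. -/
def LeftInvariantMetric.onLieAlg {G : Type*} [TopologicalSpace G]
    [ChartedSpace (EuclideanSpace ℝ (Fin 4)) G] [Group G] (g : LeftInvariantMetric G) :
    ScalarProduct (LieAlg G) := g.metric 1

/-- The endomorphism of the Lie algebra given by a left-invariant field of endomorphisms. -/
def LeftInvariantEndo.onLieAlg {G : Type*} [TopologicalSpace G]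
    [ChartedSpace (EuclideanSpace ℝ (Fin 4)) G] [Group G] (J : LeftInvariantEndo G) :
    LieAlg G →ₗ[ℝ] LieAlg G := J.endo 1

/-! ### Two-forms -/

section TwoForms

variable {V : Type*} [AddCommGroup V] [Module ℝ V]

/-- The space `Λ²` of two-forms on `V`. -/
abbrev TwoForm (V : Type*) [AddCommGroup V] [Module ℝ V] : Type _ := V [⋀^Fin 2]→ₗ[ℝ] ℝ

/-- An alternating bilinear form, regarded as an element of `Λ²`. -/
def twoFormOfBilin (B : LinearMap.BilinForm ℝ V) (hB : B.IsAlt) : TwoForm V where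
  toFun v := B (v 0) (v 1)
  map_update_add' v i x y := by
    fin_cases i <;> simp [Function.update]
  map_update_smul' v i c x := by
    fin_cases i <;> simp [Function.update]
  map_eq_zero_of_eq' v i j h hij := by
    fin_cases i <;> fin_cases j <;> simp_all [hB.self_eq_zero]

/-- The wedge product of two 2-forms. -/
def wedge (α β : TwoForm V) (x y z w : V) : ℝ :=
  α ![x, y] * β ![z, w] - α ![x, z] * β ![y, w] + α ![x, w] * β ![y, z]
    + α ![y, z] * β ![x, w] - α ![y, w] * β ![x, z] + α ![z, w] * β ![x, y]

/-- `e` is an orthonormal basis: `g(e_i, e_j) = 0` for `i ≠ j` and `g(e_i, e_i) = ±1`. -/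
def IsOrthonormalBasis (g : ScalarProduct V) (e : Module.Basis (Fin 4) ℝ V) : Prop :=
  (∀ i j, i ≠ j → g.form (e i) (e j) = 0) ∧
    ∀ i, g.form (e i) (e i) = 1 ∨ g.form (e i) (e i) = -1

/-- The two-form `(z, w) ↦ (e¹ ∧ e² ∧ e³ ∧ e⁴)(x, y, z, w)`. -/
def volumeContract (e : Module.Basis (Fin 4) ℝ V) (x y : V) : TwoForm V :=
  (e.det.curryLeft x).curryLeft y

theorem volumeContract_apply (e : Module.Basis (Fin 4) ℝ V) (x y z w : V) :
    volumeContract e x y ![z, w] = e.det ![x, y, z, w] := rfl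

/-- The Hodge star operator on `Λ²` for an orthonormal basis `e`, with the orientation of `e`:
`⋆α = ½ ∑ ε_i ε_j α(e_i, e_j) vol(e_i, e_j, ·, ·)` with `ε_i = g(e_i, e_i)`; equivalently
`e^i ∧ e^j ∧ ⋆(e^k ∧ e^l) = (δ^i_k δ^j_l - δ^i_l δ^j_k) ε_i ε_j e¹ ∧ e² ∧ e³ ∧ e⁴`. -/
def hodgeStar (g : ScalarProduct V) (e : Module.Basis (Fin 4) ℝ V) :
    Module.End ℝ (TwoForm V) where
  toFun α := (1 / 2 : ℝ) • ∑ i, ∑ j,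
    (g.form (e i) (e i) * g.form (e j) (e j) * α ![e i, e j]) • volumeContract e (e i) (e j)
  map_add' α β := by
    simp only [AlternatingMap.add_apply, mul_add, add_smul, Finset.sum_add_distrib, smul_add]
  map_smul' c α := by
    simp only [AlternatingMap.smul_apply, smul_eq_mul, RingHom.id_apply, Finset.smul_sum, smul_smul]
    refine Finset.sum_congr rfl fun i _ => Finset.sum_congr rfl fun j _ => ?_
    congr 1; ring

end TwoForms

/-! ### Levi-Civita connection and curvature, evaluated on left-invariant vector fields -/

section Curvature

variable {V : Type*} [LieRing V] [LieAlgebra ℝ V] [FiniteDimensional ℝ V]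

/-- The right-hand side of the Koszul formula for left-invariant fields, as a linear form in `Z`:
`½ (g([X,Y],Z) - g([Y,Z],X) + g([Z,X],Y))`. -/
def koszul (g : ScalarProduct V) (X Y : V) : Module.Dual ℝ V :=
  (1 / 2 : ℝ) • (g.form ⁅X, Y⁆ - (g.form X).comp (LieAlgebra.ad ℝ V Y)
    - (g.form Y).comp (LieAlgebra.ad ℝ V X))

theorem koszul_apply (g : ScalarProduct V) (X Y Z : V) :
    koszul g X Y Z = (1 / 2) * (g.form ⁅X, Y⁆ Z - g.form ⁅Y, Z⁆ X + g.form ⁅Z, X⁆ Y) := by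
  have h : g.form Y ⁅X, Z⁆ = - g.form ⁅Z, X⁆ Y := by
    rw [g.symm, ← lie_skew X Z, map_neg, LinearMap.neg_apply]
  simp [koszul, h, g.symm X ⁅Y, Z⁆]

/-- The Levi-Civita connection `X ↦ (Y ↦ ∇_X Y)`, determined by `g(∇_X Y, Z) = koszul g X Y Z`. -/
def leviCivita (g : ScalarProduct V) : V →ₗ[ℝ] V →ₗ[ℝ] V :=
  LinearMap.mk₂ ℝ (fun X Y => (g.form.toDual g.nondegenerate).symm (koszul g X Y))
    (fun X X' Y => by rw [← map_add]; congr 1; ext Z; simp [koszul_apply]; ring)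
    (fun c X Y => by rw [← map_smul]; congr 1; ext Z; simp [koszul_apply]; ring)
    (fun X Y Y' => by rw [← map_add]; congr 1; ext Z; simp [koszul_apply]; ring)
    (fun c X Y => by rw [← map_smul]; congr 1; ext Z; simp [koszul_apply]; ring)

theorem form_leviCivita (g : ScalarProduct V) (X Y Z : V) :
    g.form (leviCivita g X Y) Z = koszul g X Y Z := by
  simp [leviCivita, LinearMap.BilinForm.apply_toDual_symm_apply]

/-- The connection is metric. -/
theorem leviCivita_metric (g : ScalarProduct V) (X Y Z : V) :
    g.form (leviCivita g X Y) Z + g.form Y (leviCivita g X Z) = 0 := by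
  rw [g.symm Y, form_leviCivita, form_leviCivita, koszul_apply, koszul_apply,
    ← lie_skew Y X, ← lie_skew Z X, ← lie_skew Z Y]
  simp only [map_neg, LinearMap.neg_apply]
  ring

/-- The connection is torsion-free. -/
theorem leviCivita_torsionFree (g : ScalarProduct V) (X Y : V) :
    leviCivita g X Y - leviCivita g Y X = ⁅X, Y⁆ := by
  apply (g.form.toDual g.nondegenerate).injective
  ext Z
  simp only [LinearMap.BilinForm.toDual_def, map_sub, LinearMap.sub_apply, form_leviCivita,
    koszul_apply]
  rw [← lie_skew Y X, ← lie_skew X Z, ← lie_skew Z Y]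
  simp only [map_neg, LinearMap.neg_apply]
  ring

/-- The curvature tensor `R(X,Y) = ∇_{[X,Y]} - [∇_X, ∇_Y]`. -/
def curv (g : ScalarProduct V) : V →ₗ[ℝ] V →ₗ[ℝ] (V →ₗ[ℝ] V) :=
  LinearMap.mk₂ ℝ (fun X Y => leviCivita g ⁅X, Y⁆ -
      (leviCivita g X ∘ₗ leviCivita g Y - leviCivita g Y ∘ₗ leviCivita g X))
    (fun X X' Y => by ext Z; simp; abel)
    (fun c X Y => by ext Z; simp [smul_sub])
    (fun X Y Y' => by ext Z; simp; abel)
    (fun c X Y => by ext Z; simp [smul_sub])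

/-- The Ricci tensor `ρ(X,Y) = trace {Z ↦ R(X,Z)Y}`. -/
def ricci (g : ScalarProduct V) : LinearMap.BilinForm ℝ V :=
  LinearMap.mk₂ ℝ (fun X Y => LinearMap.trace ℝ V ((curv g X).flip Y))
    (fun X X' Y => by rw [← map_add]; congr 1; ext Z; simp)
    (fun c X Y => by rw [← map_smul]; congr 1; ext Z; simp)
    (fun X Y Y' => by rw [← map_add]; congr 1; ext Z; simp)
    (fun c X Y => by rw [← map_smul]; congr 1; ext Z; simp)

/-- The Ricci operator, `g(Ric X, Y) = ρ(X,Y)`. -/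
def ricciOp (g : ScalarProduct V) : V →ₗ[ℝ] V :=
  (g.form.toDual g.nondegenerate).symm.toLinearMap ∘ₗ ricci g

/-- The scalar curvature `τ`. -/
def scalarCurv (g : ScalarProduct V) : ℝ := LinearMap.trace ℝ V (ricciOp g)

/-- The `(0,4)` Weyl tensor in dimension four, as a bilinear form in its last two arguments:
`W(x,y,z,w) = R(x,y,z,w) - ½ (ρ(x,z)g(y,w) + g(x,z)ρ(y,w) - ρ(y,z)g(x,w) - g(y,z)ρ(x,w))
  + τ/6 (g(x,z)g(y,w) - g(y,z)g(x,w))`, where `R(x,y,z,w) = g(R(x,y)z,w)`. -/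
def weylBilin (g : ScalarProduct V) (x y : V) : LinearMap.BilinForm ℝ V :=
  g.form.compLeft (curv g x y)
    - (1 / 2 : ℝ) •
      (LinearMap.BilinForm.linMulLin (ricci g x) (g.form y)
        + LinearMap.BilinForm.linMulLin (g.form x) (ricci g y)
        - LinearMap.BilinForm.linMulLin (ricci g y) (g.form x)
        - LinearMap.BilinForm.linMulLin (g.form y) (ricci g x))
    + (scalarCurv g / 6) •
      (LinearMap.BilinForm.linMulLin (g.form x) (g.form y)
        - LinearMap.BilinForm.linMulLin (g.form y) (g.form x))

theorem weylBilin_isAlt (g : ScalarProduct V) (x y : V) : (weylBilin g x y).IsAlt := by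
  have skew : ∀ X Z : V, g.form (leviCivita g X Z) Z = 0 := fun X Z => by
    have := leviCivita_metric g X Z Z
    rw [g.symm Z] at this
    linarith
  intro z
  have h1 := leviCivita_metric g x (leviCivita g y z) z
  have h2 := leviCivita_metric g y (leviCivita g x z) z
  have h3 := g.symm (leviCivita g y z) (leviCivita g x z)
  have h4 := skew ⁅x, y⁆ z
  simp [weylBilin, curv]
  linarith

/-- The Weyl tensor `W(x,y,·,·)` as a two-form. -/
def weyl (g : ScalarProduct V) (x y : V) : TwoForm V :=
  twoFormOfBilin (weylBilin g x y) (weylBilin_isAlt g x y)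

/-- The Weyl curvature operator on `Λ²`, `W(α) = ½ ∑ ε_i ε_j α(e_i, e_j) W(e_i, e_j, ·, ·)` for an
orthonormal basis `e`; it satisfies `⟨⟨W(x ∧ y), z ∧ w⟩⟩ = W(x,y,z,w)`. -/
def weylOp (g : ScalarProduct V) (e : Module.Basis (Fin 4) ℝ V) : Module.End ℝ (TwoForm V) where
  toFun α := (1 / 2 : ℝ) • ∑ i, ∑ j,
    (g.form (e i) (e i) * g.form (e j) (e j) * α ![e i, e j]) • weyl g (e i) (e j)
  map_add' α β := by
    simp only [AlternatingMap.add_apply, mul_add, add_smul, Finset.sum_add_distrib, smul_add]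
  map_smul' c α := by
    simp only [AlternatingMap.smul_apply, smul_eq_mul, RingHom.id_apply, Finset.smul_sum, smul_smul]
    refine Finset.sum_congr rfl fun i _ => Finset.sum_congr rfl fun j _ => ?_
    congr 1; ring

/-- The self-dual Weyl curvature operator `W⁺ = ½ (W + ⋆W)`. -/
def weylPlus (g : ScalarProduct V) (e : Module.Basis (Fin 4) ℝ V) : Module.End ℝ (TwoForm V) :=
  (1 / 2 : ℝ) • (weylOp g e + hodgeStar g e * weylOp g e)

/-- The anti-self-dual Weyl curvature operator `W⁻ = ½ (W - ⋆W)`. -/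
def weylMinus (g : ScalarProduct V) (e : Module.Basis (Fin 4) ℝ V) : Module.End ℝ (TwoForm V) :=
  (1 / 2 : ℝ) • (weylOp g e - hodgeStar g e * weylOp g e)

end Curvature

/-! ### Almost para-Kähler structures and symplectic pairs -/

section Structures

variable {V : Type*} [LieRing V] [LieAlgebra ℝ V] [FiniteDimensional ℝ V]

/-- The exterior derivative of a left-invariant 2-form, on left-invariant vector fields. -/
def extDerivTwo (Ω : TwoForm V) (X Y Z : V) : ℝ :=
  -Ω ![⁅X, Y⁆, Z] + Ω ![⁅X, Z⁆, Y] - Ω ![⁅Y, Z⁆, X]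

/-- A left-invariant symplectic form. -/
structure IsSymplectic (Ω : TwoForm V) : Prop where
  nondegenerate : ∀ X, (∀ Y, Ω ![X, Y] = 0) → X = 0
  closed : ∀ X Y Z, extDerivTwo Ω X Y Z = 0

/-- A symplectic pair `(Ω₊, Ω₋)`: symplectic forms with `Ω₊ ∧ Ω₋ = 0` and
`Ω₊ ∧ Ω₊ = -Ω₋ ∧ Ω₋`. -/
structure IsSymplecticPair (Ωp Ωm : TwoForm V) : Prop where
  symplectic_plus : IsSymplectic Ωp
  symplectic_minus : IsSymplectic Ωm
  wedge_eq_zero : ∀ x y z w, wedge Ωp Ωm x y z w = 0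
  wedge_self : ∀ x y z w, wedge Ωp Ωp x y z w = -wedge Ωm Ωm x y z w

/-- `(g, J)` is an almost para-Kähler structure with fundamental form `Ω`: `J² = id`,
`g(JX,JY) = -g(X,Y)`, `Ω(X,Y) = g(JX,Y)` and `dΩ = 0`. -/
structure IsAlmostParaKahler (g : ScalarProduct V) (J : V →ₗ[ℝ] V) (Ω : TwoForm V) : Prop where
  sq : ∀ X, J (J X) = X
  anti_isometry : ∀ X Y, g.form (J X) (J Y) = -g.form X Y
  fundamental : ∀ X Y, Ω ![X, Y] = g.form (J X) Y
  closed : ∀ X Y Z, extDerivTwo Ω X Y Z = 0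

/-- `∇Ω = 0` for the Levi-Civita connection of `g`. -/
def IsParallel (g : ScalarProduct V) (Ω : TwoForm V) : Prop :=
  ∀ X Y Z, Ω ![leviCivita g X Y, Z] + Ω ![Y, leviCivita g X Z] = 0

end Structures

/-! ### The three algebraic types -/

/-- `f` is diagonalizable over `ℝ`. -/
def IsDiagonalizable {M : Type*} [AddCommGroup M] [Module ℝ M] (f : Module.End ℝ M) : Prop :=
  ⨆ μ : ℝ, f.eigenspace μ = ⊤

variable {V : Type*} [LieRing V] [LieAlgebra ℝ V] [FiniteDimensional ℝ V]

/-- Both `W⁺` and `W⁻` are diagonalizable. -/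
def CaseDiagonalizable (g : ScalarProduct V) (e : Module.Basis (Fin 4) ℝ V) : Prop :=
  IsDiagonalizable (weylPlus g e) ∧ IsDiagonalizable (weylMinus g e)

/-- The minimal polynomial of `W⁺` has a non-zero double root. As the root is non-zero, it does
not matter that `W⁺` is taken on `Λ²`, where it vanishes on `Λ⁻`, instead of on `Λ⁺`. -/
def CaseDoubleRoot (g : ScalarProduct V) (e : Module.Basis (Fin 4) ℝ V) : Prop :=
  ∃ μ : ℝ, μ ≠ 0 ∧ (minpoly ℝ (weylPlus g e)).rootMultiplicity μ = 2

/-- The metric is self-dual (`W⁻ = 0`), non-flat, and `W⁺` is two-step nilpotent. -/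
def CaseTwoStepNilpotent (g : ScalarProduct V) (e : Module.Basis (Fin 4) ℝ V) : Prop :=
  weylMinus g e = 0 ∧ weylPlus g e ≠ 0 ∧ weylPlus g e ^ 2 = 0 ∧ curv g ≠ 0

end ParaLie

end

/-!
Everything takes place on the Lie algebra of left-invariant fields. The wedge conditions make
`Ω₊ + Ω₋` and `Ω₊ - Ω₋` decomposable, and their kernels are complementary eigenspaces of `J₊J₋`, so
`J₊` and `J₋` have a common null eigenframe `a, b, c, d` with `g(a,b) = g(c,d) = 1`
(`exists_adaptedFrame`). Because `Ω₋` is parallel, the Levi-Civita connection preserves the spans of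
`a, d` and of `b, c`, and is given by four connection forms `α, β, γ, δ`; that `Ω₊` is closed kills
four of their sixteen values (`IsAdaptedFrame.exists_connection`). Twelve coefficients remain. They
satisfy the quadratic Jacobi identity and the two equations `ρ(a,c) = ρ(b,d) = 0`, to which the
`J₊`-invariance of the Ricci operator reduces (`CoefficientRelations`).

The forms `β` and `γ` have at most two non-zero coefficients each. Inspecting which of these four
numbers vanish, up to the two symmetries of the frame, shows that the mixed curvature components
vanish and that `p = R(a,c,a,c)` and `q = R(b,d,b,d)` both vanish unless `β = 0` or `γ = 0`
(`CoefficientRelations.vanishingPattern`). With `t = R(a,c,b,d)` and the scalar curvature `τ`, the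
operator `W⁺` then acts on `Λ⁺` by

* `2κ` on `a* ∧ b* + c* ∧ d*`, where `κ = τ/12 - t`,
* `-κ` plus the off-diagonal entries `p` and `q` on the span of `a* ∧ c*` and `b* ∧ d*`,

while `W⁻` is diagonal with eigenvalues `τ/6, -τ/12, -τ/12`. If `p = q = 0`, both are diagonal.
Otherwise exactly one of `p, q` is non-zero and `t = 0`, so `κ = τ/12`: for `τ ≠ 0` there is a
Jordan block with the non-zero eigenvalue `-τ/12`, and for `τ = 0` one has `W⁻ = 0`, `W⁺ ≠ 0` and
`(W⁺)² = 0` (`type_of_reducedCurvature`). The three types exclude each other by general facts on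
minimal polynomials (`exactly_one_of_some`).
-/

noncomputable section

namespace ParaLie

/-! ### Null frames and contractions -/

theorem update_zero {V : Type*} (x y z : V) : Function.update ![x, y] 0 z = ![z, y] := by
  ext i; fin_cases i <;> rfl

theorem update_one {V : Type*} (x y z : V) : Function.update ![x, y] 1 z = ![x, z] := by
  ext i; fin_cases i <;> rfl

section Frames

variable {V : Type*} [AddCommGroup V] [Module ℝ V]

/-- A frame `a, b, c, d` of a neutral four-dimensional scalar product space that splits it into
two orthogonal hyperbolic planes: `g(a,b) = g(c,d) = 1` and all other products vanish. -/
structure IsNullFrame (g : ScalarProduct V) (a b c d : V) : Prop where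
  ab : g.form a b = 1
  cd : g.form c d = 1
  aa : g.form a a = 0
  bb : g.form b b = 0
  cc : g.form c c = 0
  dd : g.form d d = 0
  ac : g.form a c = 0
  ad : g.form a d = 0
  bc : g.form b c = 0
  bd : g.form b d = 0
  expand : ∀ x, x = g.form x b • a + g.form x a • b + g.form x d • c + g.form x c • d

namespace IsNullFrame

variable {g : ScalarProduct V} {a b c d : V}

theorem ba (h : IsNullFrame g a b c d) : g.form b a = 1 := by rw [g.symm, h.ab]
theorem dc (h : IsNullFrame g a b c d) : g.form d c = 1 := by rw [g.symm, h.cd]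
theorem ca (h : IsNullFrame g a b c d) : g.form c a = 0 := by rw [g.symm, h.ac]
theorem da (h : IsNullFrame g a b c d) : g.form d a = 0 := by rw [g.symm, h.ad]
theorem cb (h : IsNullFrame g a b c d) : g.form c b = 0 := by rw [g.symm, h.bc]
theorem db (h : IsNullFrame g a b c d) : g.form d b = 0 := by rw [g.symm, h.bd]

/-- The frame with the roles of the two null directions exchanged in both planes. -/
theorem swap (h : IsNullFrame g a b c d) : IsNullFrame g b a d c where
  ab := h.ba
  cd := h.dc
  aa := h.bb
  bb := h.aa
  cc := h.dd
  dd := h.cc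
  ac := h.bd
  ad := h.bc
  bc := h.ad
  bd := h.ac
  expand x := by rw [add_assoc]; nth_rw 1 [h.expand x]; abel

theorem hom_ext (h : IsNullFrame g a b c d) {S T : V →ₗ[ℝ] V} (ha : S a = T a)
    (hb : S b = T b) (hc : S c = T c) (hd : S d = T d) : S = T := by
  ext x
  rw [h.expand x]
  simp only [map_add, map_smul, ha, hb, hc, hd]

end IsNullFrame

/-- Expansion of a linear functional along an orthonormal basis. -/
theorem sum_orthonormal_expand (g : ScalarProduct V) {e : Module.Basis (Fin 4) ℝ V}
    (he : IsOrthonormalBasis g e) (φ : V →ₗ[ℝ] ℝ) (u : V) :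
    ∑ i, g.form (e i) (e i) * (g.form (e i) u * φ (e i)) = φ u := by
  have key : ∀ i, g.form (e i) u = e.repr u i * g.form (e i) (e i) := fun i => by
    conv_lhs => rw [← e.sum_repr u]
    rw [map_sum, Finset.sum_eq_single i]
    · simp
    · intro j _ hj
      simp [he.1 i j hj.symm]
    · simp
  have hsq : ∀ i, g.form (e i) (e i) * g.form (e i) (e i) = 1 := fun i => by
    rcases he.2 i with h | h <;> simp [h]
  conv_rhs => rw [← e.sum_repr u]
  rw [map_sum]
  refine Finset.sum_congr rfl fun i _ => ?_
  rw [key, map_smul, smul_eq_mul]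
  linear_combination (e.repr u i * φ (e i)) * hsq i

/-- The metric contraction of a bilinear form does not depend on the frame: it can be computed in
an orthonormal basis or in a null frame. -/
theorem sum_orthonormal_eq_nullFrame {g : ScalarProduct V} {e : Module.Basis (Fin 4) ℝ V}
    (he : IsOrthonormalBasis g e) {a b c d : V} (h : IsNullFrame g a b c d)
    (B : LinearMap.BilinForm ℝ V) :
    ∑ i, g.form (e i) (e i) * B (e i) (e i) = B a b + B b a + B c d + B d c := by
  have hx : ∀ x, B x x = g.form x b * B.flip a x + g.form x a * B.flip b x
      + g.form x d * B.flip c x + g.form x c * B.flip d x := fun x => by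
    conv_lhs => rw [h.expand x, ← h.expand x]
    nth_rw 2 [h.expand x]
    simp
  have e1 := sum_orthonormal_expand g he (B.flip a) b
  have e2 := sum_orthonormal_expand g he (B.flip b) a
  have e3 := sum_orthonormal_expand g he (B.flip c) d
  have e4 := sum_orthonormal_expand g he (B.flip d) c
  simp only [hx, mul_add, Finset.sum_add_distrib, e1, e2, e3, e4]
  simp only [LinearMap.BilinForm.flip_apply]
  ring

/-- Contraction of the product of two bilinear forms, computed in a null frame. -/
theorem sum_sum_orthonormal_eq_nullFrame {g : ScalarProduct V} {e : Module.Basis (Fin 4) ℝ V}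
    (he : IsOrthonormalBasis g e) {a b c d : V} (h : IsNullFrame g a b c d)
    (A B : LinearMap.BilinForm ℝ V) :
    ∑ i, ∑ j, g.form (e i) (e i) * g.form (e j) (e j) * A (e i) (e j) * B (e i) (e j) =
      (A a a * B b b + A a b * B b a + A a c * B b d + A a d * B b c)
      + (A b a * B a b + A b b * B a a + A b c * B a d + A b d * B a c)
      + (A c a * B d b + A c b * B d a + A c c * B d d + A c d * B d c)
      + (A d a * B c b + A d b * B c a + A d c * B c d + A d d * B c c) := by
  have h1 : ∀ i, ∑ j, g.form (e i) (e i) * g.form (e j) (e j) * A (e i) (e j) * B (e i) (e j) =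
      g.form (e i) (e i) * LinearMap.BilinForm.linMulLin (A.flip a) (B.flip b) (e i) (e i)
      + g.form (e i) (e i) * LinearMap.BilinForm.linMulLin (A.flip b) (B.flip a) (e i) (e i)
      + g.form (e i) (e i) * LinearMap.BilinForm.linMulLin (A.flip c) (B.flip d) (e i) (e i)
      + g.form (e i) (e i) * LinearMap.BilinForm.linMulLin (A.flip d) (B.flip c) (e i) (e i) := by
    intro i
    have := sum_orthonormal_eq_nullFrame he h
      (LinearMap.BilinForm.linMulLin (A (e i)) (B (e i)))
    simp only [LinearMap.BilinForm.linMulLin_apply, LinearMap.BilinForm.flip_apply] at this ⊢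
    rw [← mul_add, ← mul_add, ← mul_add, ← this, Finset.mul_sum]
    exact Finset.sum_congr rfl fun j _ => by ring
  simp only [h1, Finset.sum_add_distrib, sum_orthonormal_eq_nullFrame he h]
  simp only [LinearMap.BilinForm.linMulLin_apply, LinearMap.BilinForm.flip_apply]
  ring

theorem trace_eq_nullFrame {g : ScalarProduct V} {e : Module.Basis (Fin 4) ℝ V}
    (he : IsOrthonormalBasis g e) {a b c d : V} (h : IsNullFrame g a b c d) (T : V →ₗ[ℝ] V) :
    LinearMap.trace ℝ V T =
      g.form (T a) b + g.form (T b) a + g.form (T c) d + g.form (T d) c := by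
  have h1 := sum_orthonormal_eq_nullFrame he h (g.form.compLeft T)
  simp only [LinearMap.BilinForm.compLeft_apply] at h1
  rw [← h1, LinearMap.trace_eq_matrix_trace ℝ e T, Matrix.trace]
  refine Finset.sum_congr rfl fun i _ => ?_
  rw [Matrix.diag_apply, LinearMap.toMatrix_apply, ← e.coord_apply,
    ← sum_orthonormal_expand g he (e.coord i)]
  rw [Finset.sum_eq_single i]
  · simp [g.symm (e i) (T (e i))]
  · intro j _ hj
    simp [hj]
  · simp

/-! ### Two-forms in a null frame -/

/-- A two-form as a bilinear form. -/
def TwoForm.toBilin (α : TwoForm V) : LinearMap.BilinForm ℝ V :=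
  LinearMap.mk₂ ℝ (fun x y => α ![x, y])
    (fun x x' y => by simpa only [update_zero] using α.map_update_add ![x, y] 0 x x')
    (fun r x y => by simpa only [update_zero] using α.map_update_smul ![x, y] 0 r x)
    (fun x y y' => by simpa only [update_one] using α.map_update_add ![x, y] 1 y y')
    (fun r x y => by simpa only [update_one] using α.map_update_smul ![x, y] 1 r y)

@[simp] theorem TwoForm.toBilin_apply (α : TwoForm V) (x y : V) : α.toBilin x y = α ![x, y] := rfl

theorem TwoForm.self (α : TwoForm V) (x : V) : α ![x, x] = 0 :=
  α.map_eq_zero_of_eq ![x, x] (i := 0) (j := 1) rfl (by simp)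

theorem TwoForm.skew (α : TwoForm V) (x y : V) : α ![x, y] = -α ![y, x] := by
  have h := α.self (x + y)
  simp only [← TwoForm.toBilin_apply, map_add, LinearMap.add_apply] at h
  simp only [TwoForm.toBilin_apply, α.self] at h
  linarith

theorem twoForm_sum_apply {ι : Type*} (s : Finset ι) (θ : ι → TwoForm V) (v : Fin 2 → V) :
    (∑ i ∈ s, θ i) v = ∑ i ∈ s, θ i v :=
  map_sum (⟨⟨fun α : TwoForm V => α v, rfl⟩, fun _ _ => rfl⟩ : TwoForm V →+ ℝ) θ s

/-- A two-form is determined by its six components in a null frame. -/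
theorem TwoForm.ext_nullFrame {g : ScalarProduct V} {a b c d : V} (h : IsNullFrame g a b c d)
    {α β : TwoForm V} (hab : α ![a, b] = β ![a, b]) (hcd : α ![c, d] = β ![c, d])
    (hac : α ![a, c] = β ![a, c]) (hbd : α ![b, d] = β ![b, d])
    (had : α ![a, d] = β ![a, d]) (hbc : α ![b, c] = β ![b, c]) : α = β := by
  have key : ∀ x y, α.toBilin x y = β.toBilin x y := by
    intro x y
    rw [h.expand x, h.expand y]
    simp only [map_add, map_smul, LinearMap.add_apply, LinearMap.smul_apply,
      TwoForm.toBilin_apply, TwoForm.self, α.skew b a, β.skew b a, α.skew c a, β.skew c a,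
      α.skew d a, β.skew d a, α.skew c b, β.skew c b, α.skew d b, β.skew d b,
      α.skew d c, β.skew d c, hab, hcd, hac, hbd, had, hbc]
  ext v
  have hv : v = ![v 0, v 1] := by ext i; fin_cases i <;> rfl
  rw [hv]
  exact key _ _

/-- The two-form `φ ∧ ψ`. -/
def wedgeDual (φ ψ : Module.Dual ℝ V) : TwoForm V :=
  twoFormOfBilin (LinearMap.BilinForm.linMulLin φ ψ - LinearMap.BilinForm.linMulLin ψ φ)
    (fun x => by simp [mul_comm])

theorem wedgeDual_apply (φ ψ : Module.Dual ℝ V) (x y : V) :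
    wedgeDual φ ψ ![x, y] = φ x * ψ y - ψ x * φ y := by
  simp [wedgeDual, twoFormOfBilin]

/-- The Hodge star in a null frame. For a two-form that is self-dual of type `a* ∧ b* + c* ∧ d*`
the orientation has to be the one with `vol(a,b,c,d) = -1`. -/
theorem hodgeStar_nullFrame {g : ScalarProduct V} {e : Module.Basis (Fin 4) ℝ V}
    (he : IsOrthonormalBasis g e) {a b c d : V} (h : IsNullFrame g a b c d) (α : TwoForm V) :
    hodgeStar g e α ![a, b] = -e.det ![a, b, c, d] * α ![c, d] ∧
    hodgeStar g e α ![c, d] = -e.det ![a, b, c, d] * α ![a, b] ∧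
    hodgeStar g e α ![a, c] = -e.det ![a, b, c, d] * α ![a, c] ∧
    hodgeStar g e α ![b, d] = -e.det ![a, b, c, d] * α ![b, d] ∧
    hodgeStar g e α ![a, d] = e.det ![a, b, c, d] * α ![a, d] ∧
    hodgeStar g e α ![b, c] = e.det ![a, b, c, d] * α ![b, c] := by
  -- the contraction of `α` with the volume form, as a contraction of bilinear forms
  have expand : ∀ z w, hodgeStar g e α ![z, w] = (1 / 2 : ℝ) * ∑ i, ∑ j,
      g.form (e i) (e i) * g.form (e j) (e j) * α.toBilin (e i) (e j) *
        (volumeContract e z w).toBilin (e i) (e j) := by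
    intro z w
    have hs : ∀ x y, volumeContract e x y ![z, w] = volumeContract e z w ![x, y] := by
      intro x y
      rw [volumeContract_apply, volumeContract_apply]
      have h1 := e.det.map_swap ![x, y, z, w] (i := 0) (j := 2) (by decide)
      have h2 := e.det.map_swap ![z, y, x, w] (i := 1) (j := 3) (by decide)
      have e1 : ![x, y, z, w] ∘ ⇑(Equiv.swap (0 : Fin 4) 2) = ![z, y, x, w] := by
        ext i; fin_cases i <;> rfl
      have e2 : ![z, y, x, w] ∘ ⇑(Equiv.swap (1 : Fin 4) 3) = ![z, w, x, y] := by
        ext i; fin_cases i <;> rfl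
      rw [e1] at h1
      rw [e2] at h2
      linarith
    simp only [hodgeStar, LinearMap.coe_mk, AddHom.coe_mk, AlternatingMap.smul_apply,
      twoForm_sum_apply, smul_eq_mul, hs, TwoForm.toBilin_apply]
  have s01 : ∀ x y z w, e.det ![y, x, z, w] = -e.det ![x, y, z, w] := fun x y z w => by
    rw [← e.det.map_swap ![x, y, z, w] (i := 0) (j := 1) (by decide)]
    congr 1; ext i; fin_cases i <;> rfl
  have s12 : ∀ x y z w, e.det ![x, z, y, w] = -e.det ![x, y, z, w] := fun x y z w => by
    rw [← e.det.map_swap ![x, y, z, w] (i := 1) (j := 2) (by decide)]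
    congr 1; ext i; fin_cases i <;> rfl
  have s23 : ∀ x y z w, e.det ![x, y, w, z] = -e.det ![x, y, z, w] := fun x y z w => by
    rw [← e.det.map_swap ![x, y, z, w] (i := 2) (j := 3) (by decide)]
    congr 1; ext i; fin_cases i <;> rfl
  have z01 : ∀ x z w, e.det ![x, x, z, w] = 0 := fun x z w => by linarith [s01 x x z w]
  have z12 : ∀ x z w, e.det ![x, z, z, w] = 0 := fun x z w => by linarith [s12 x z z w]
  have z02 : ∀ x z w, e.det ![x, z, x, w] = 0 := fun x z w => by
    rw [s12, z01, neg_zero]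
  have z13 : ∀ x z w, e.det ![x, z, w, z] = 0 := fun x z w => by
    rw [s23, z12, neg_zero]
  have z03 : ∀ x z w, e.det ![x, z, w, x] = 0 := fun x z w => by
    rw [s23, z02, neg_zero]
  have p1 : e.det ![c, d, a, b] = e.det ![a, b, c, d] := by
    rw [s12 c a d b, s01 a c d b, s23 a c b d, s12 a b c d]; ring
  have p2 : e.det ![a, c, b, d] = -e.det ![a, b, c, d] := s12 a b c d
  have p3 : e.det ![b, d, a, c] = -e.det ![a, b, c, d] := by
    rw [s12 b a d c, s01 a b d c, s23 a b c d]; ring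
  have p4 : e.det ![a, d, b, c] = e.det ![a, b, c, d] := by
    rw [s12 a b d c, s23 a b c d]; ring
  have p5 : e.det ![b, c, a, d] = e.det ![a, b, c, d] := by
    rw [s12 b a c d, s01 a b c d]; ring
  refine ⟨?_, ?_, ?_, ?_, ?_, ?_⟩ <;>
  · rw [expand, sum_sum_orthonormal_eq_nullFrame he h]
    simp only [TwoForm.toBilin_apply, volumeContract_apply, TwoForm.self, α.skew b a, α.skew c a,
      α.skew d a, α.skew c b, α.skew d b, α.skew d c, z12, z02, z13, z03,
      s23 _ _ a b, s23 _ _ a c, s23 _ _ a d, s23 _ _ b c, s23 _ _ b d, s23 _ _ c d,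
      p1, p2, p3, p4, p5]
    ring

end Frames

/-! ### Adapted null frames of a symplectic pair -/

section Existence

variable {V : Type*} [AddCommGroup V] [Module ℝ V]

/-- A two-form with `σ ∧ σ = 0` has a kernel of codimension at most two. -/
theorem two_le_finrank_ker [FiniteDimensional ℝ V] (hV : Module.finrank ℝ V = 4) (σ : TwoForm V)
    (h : ∀ x y z w, wedge σ σ x y z w = 0) :
    2 ≤ Module.finrank ℝ (LinearMap.ker σ.toBilin) := by
  by_cases h0 : ∃ x y, σ ![x, y] ≠ 0
  · obtain ⟨x, y, hxy⟩ := h0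
    have hle : LinearMap.ker ((σ.toBilin x).prod (σ.toBilin y)) ≤ LinearMap.ker σ.toBilin := by
      intro z hz
      have hz1 : σ ![x, z] = 0 := congrArg Prod.fst (LinearMap.mem_ker.1 hz)
      have hz2 : σ ![y, z] = 0 := congrArg Prod.snd (LinearMap.mem_ker.1 hz)
      rw [LinearMap.mem_ker]
      ext w
      have := h x y z w
      simp only [wedge, hz1, hz2] at this
      have h2 : σ ![x, y] * σ ![z, w] = 0 := by linarith
      simpa [hxy] using h2
    have h1 := LinearMap.finrank_range_add_finrank_ker ((σ.toBilin x).prod (σ.toBilin y))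
    have h2 := Submodule.finrank_mono hle
    have h3 := Submodule.finrank_le (LinearMap.range ((σ.toBilin x).prod (σ.toBilin y)))
    simp only [Module.finrank_prod, Module.finrank_self] at h3
    omega
  · push Not at h0
    have : LinearMap.ker σ.toBilin = ⊤ := by
      rw [LinearMap.ker_eq_top]
      ext x y
      simp [h0]
    rw [this, finrank_top]
    omega

/-- Four vectors with the products of a null frame form a null frame in dimension four. -/
theorem isNullFrame_of_products (hV : Module.finrank ℝ V = 4) {g : ScalarProduct V} {a b c d : V}
    (ab : g.form a b = 1) (cd : g.form c d = 1) (aa : g.form a a = 0) (bb : g.form b b = 0)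
    (cc : g.form c c = 0) (dd : g.form d d = 0) (ac : g.form a c = 0) (ad : g.form a d = 0)
    (bc : g.form b c = 0) (bd : g.form b d = 0) : IsNullFrame g a b c d := by
  have ba := g.symm b a
  have dc := g.symm d c
  have ca := g.symm c a
  have da := g.symm d a
  have cb := g.symm c b
  have db := g.symm d b
  rw [ab] at ba
  rw [cd] at dc
  rw [ac] at ca
  rw [ad] at da
  rw [bc] at cb
  rw [bd] at db
  have hli : LinearIndependent ℝ ![a, b, c, d] := by
    rw [Fintype.linearIndependent_iff]
    intro r hr
    simp only [Fin.sum_univ_four, Matrix.cons_val] at hr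
    have key : ∀ y, r 0 * g.form a y + r 1 * g.form b y + r 2 * g.form c y
        + r 3 * g.form d y = 0 := fun y => by
      simpa using congrArg (fun x => g.form x y) hr
    have k1 := key a
    have k2 := key b
    have k3 := key c
    have k4 := key d
    simp only [ab, cd, aa, bb, cc, dd, ac, ad, bc, bd, ba, dc, ca, da, cb, db] at k1 k2 k3 k4
    intro i
    fin_cases i <;> simp <;> linarith
  refine ⟨ab, cd, aa, bb, cc, dd, ac, ad, bc, bd, fun x => ?_⟩
  have : Nonempty (Fin 4) := ⟨0⟩
  let f := basisOfLinearIndependentOfCardEqFinrank hli (by simp [hV])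
  have hf : ⇑f = ![a, b, c, d] := coe_basisOfLinearIndependentOfCardEqFinrank hli (by simp [hV])
  have hx := f.sum_repr x
  rw [hf] at hx
  simp only [Fin.sum_univ_four, Matrix.cons_val] at hx
  generalize f.repr x 0 = r0 at hx
  generalize f.repr x 1 = r1 at hx
  generalize f.repr x 2 = r2 at hx
  generalize f.repr x 3 = r3 at hx
  subst hx
  simp only [map_add, map_smul, LinearMap.add_apply, LinearMap.smul_apply, smul_eq_mul,
    ab, cd, aa, bb, cc, dd, ac, ad, bc, bd, ba, dc, ca, da, cb, db]
  simp

/-- A subspace that is invariant under a para-complex structure `J` with `g(JX,JY) = -g(X,Y)` and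
on which `g` does not vanish contains null eigenvectors of `J` with product one. -/
theorem exists_hyperbolic_pair {g : ScalarProduct V} {J : V →ₗ[ℝ] V} (hsq : ∀ x, J (J x) = x)
    (hanti : ∀ x y, g.form (J x) (J y) = -g.form x y) (D : Submodule ℝ V)
    (hD : ∀ x ∈ D, J x ∈ D) {x y : V} (hx : x ∈ D) (hy : y ∈ D) (hxy : g.form x y ≠ 0) :
    ∃ a ∈ D, ∃ b ∈ D, J a = a ∧ J b = -b ∧ g.form a b = 1 := by
  -- one of the mixed products of the `±1`-components of `x` and `y` is non-zero
  have main : ∀ u ∈ D, ∀ v ∈ D, g.form (u + J u) (v - J v) ≠ 0 →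
      ∃ a ∈ D, ∃ b ∈ D, J a = a ∧ J b = -b ∧ g.form a b = 1 := by
    intro u hu v hv huv
    refine ⟨(g.form (u + J u) (v - J v))⁻¹ • (u + J u),
      D.smul_mem _ (D.add_mem hu (hD u hu)), v - J v, D.sub_mem hv (hD v hv), ?_, ?_, ?_⟩
    · rw [map_smul, J.map_add, hsq, add_comm (J u)]
    · rw [map_sub, hsq, neg_sub]
    · rw [map_smul, LinearMap.smul_apply, smul_eq_mul, inv_mul_cancel₀ huv]
  by_cases h1 : g.form (x + J x) (y - J y) ≠ 0
  · exact main x hx y hy h1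
  · by_cases h2 : g.form (y + J y) (x - J x) ≠ 0
    · exact main y hy x hx h2
    · push Not at h1 h2
      exfalso
      apply hxy
      have e1 := hanti x y
      have e2 := g.symm (J y) x
      have e3 := g.symm (J y) (J x)
      have e4 := g.symm y (J x)
      have e5 := g.symm y x
      simp only [map_add, map_sub, LinearMap.add_apply] at h1 h2
      linarith

/-- A null frame of common eigenvectors of `J₊` and `J₋`, which agree on the plane spanned by `a, b`
and are opposite on the plane spanned by `c, d`. -/
structure IsAdaptedFrame (g : ScalarProduct V) (Jp Jm : V →ₗ[ℝ] V) (a b c d : V) : Prop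
    extends IsNullFrame g a b c d where
  Jp_a : Jp a = a
  Jp_b : Jp b = -b
  Jp_c : Jp c = c
  Jp_d : Jp d = -d
  Jm_a : Jm a = a
  Jm_b : Jm b = -b
  Jm_c : Jm c = -c
  Jm_d : Jm d = d

end Existence

/-- The wedge conditions force `J₊J₋` to be an involution: the two-forms `Ω₊ ± Ω₋` are
decomposable, and their two-dimensional kernels are the `∓1`-eigenspaces of `J₊J₋`, which therefore
span. Each eigenspace is a hyperbolic plane for `g`. -/
theorem exists_adaptedFrame {V : Type*} [LieRing V] [LieAlgebra ℝ V] [FiniteDimensional ℝ V]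
    (hV : Module.finrank ℝ V = 4) {g : ScalarProduct V}
    {Jp Jm : V →ₗ[ℝ] V} {Ωp Ωm : TwoForm V} (hJp : IsAlmostParaKahler g Jp Ωp)
    (hJm : IsAlmostParaKahler g Jm Ωm) (hpair : IsSymplecticPair Ωp Ωm) :
    ∃ a b c d, IsAdaptedFrame g Jp Jm a b c d := by
  have hnd : ∀ x, (∀ y, g.form x y = 0) → x = 0 := fun x hx =>
    (g.form.toDual g.nondegenerate).injective (by
      ext y
      rw [LinearMap.BilinForm.toDual_def, hx, map_zero, LinearMap.zero_apply])
  have wsymm : ∀ x y z w, wedge Ωm Ωp x y z w = wedge Ωp Ωm x y z w := fun x y z w => by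
    simp only [wedge]; ring
  -- the kernels of the two decomposable forms
  have hplus := two_le_finrank_ker hV (Ωp + Ωm) (fun x y z w => by
    have h1 := hpair.wedge_eq_zero x y z w
    have h2 := hpair.wedge_self x y z w
    simp only [wedge, AlternatingMap.add_apply] at h1 h2 ⊢
    linarith)
  have hminus := two_le_finrank_ker hV (Ωp - Ωm) (fun x y z w => by
    have h1 := hpair.wedge_eq_zero x y z w
    have h2 := hpair.wedge_self x y z w
    simp only [wedge, AlternatingMap.sub_apply] at h1 h2 ⊢
    linarith)
  set D₂ := LinearMap.ker (Ωp + Ωm).toBilin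
  set D₁ := LinearMap.ker (Ωp - Ωm).toBilin
  have mem₁ : ∀ x, x ∈ D₁ ↔ Jm x = Jp x := by
    intro x
    rw [LinearMap.mem_ker]
    constructor
    · intro h
      rw [← sub_eq_zero]
      refine hnd _ fun y => ?_
      have := congrArg (fun φ => φ y) h
      simp only [TwoForm.toBilin_apply, AlternatingMap.sub_apply, hJp.fundamental,
        hJm.fundamental, LinearMap.zero_apply] at this
      rw [map_sub, LinearMap.sub_apply]
      linarith
    · intro h
      ext y
      simp [hJp.fundamental, hJm.fundamental, h]
  have mem₂ : ∀ x, x ∈ D₂ ↔ Jm x = -Jp x := by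
    intro x
    rw [LinearMap.mem_ker]
    constructor
    · intro h
      rw [← add_eq_zero_iff_eq_neg]
      refine hnd _ fun y => ?_
      have := congrArg (fun φ => φ y) h
      simp only [TwoForm.toBilin_apply, AlternatingMap.add_apply, hJp.fundamental,
        hJm.fundamental, LinearMap.zero_apply] at this
      rw [map_add, LinearMap.add_apply]
      linarith
    · intro h
      ext y
      simp [hJp.fundamental, hJm.fundamental, h]
  have inv₁ : ∀ x ∈ D₁, Jp x ∈ D₁ := fun x hx => by
    rw [mem₁] at hx ⊢
    rw [← hx, hJm.sq, hx, hJp.sq]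
  have inv₂ : ∀ x ∈ D₂, Jp x ∈ D₂ := fun x hx => by
    rw [mem₂] at hx ⊢
    rw [eq_neg_iff_add_eq_zero, add_comm, ← eq_neg_iff_add_eq_zero] at hx
    rw [hJp.sq, hx, map_neg, hJm.sq]
  have orth : ∀ x ∈ D₁, ∀ y ∈ D₂, g.form x y = 0 := fun x hx y hy => by
    have h1 := hJp.anti_isometry x y
    have h2 := hJm.anti_isometry x y
    rw [(mem₁ x).1 hx, (mem₂ y).1 hy, map_neg, h1] at h2
    linarith
  have hinf : D₁ ⊓ D₂ = ⊥ := by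
    rw [eq_bot_iff]
    rintro x ⟨hx1, hx2⟩
    have h1 := (mem₁ x).1 hx1
    have h2 := (mem₂ x).1 hx2
    rw [h1, eq_neg_iff_add_eq_zero, ← two_smul ℝ, smul_eq_zero] at h2
    have h3 := h2.resolve_left two_ne_zero
    rw [Submodule.mem_bot, ← hJp.sq x, h3, map_zero]
  have hsup : D₁ ⊔ D₂ = ⊤ := by
    apply Submodule.eq_top_of_finrank_eq
    have h1 := Submodule.finrank_sup_add_finrank_inf_eq D₁ D₂
    have h2 := Submodule.finrank_le (D₁ ⊔ D₂)
    rw [hinf, finrank_bot] at h1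
    omega
  -- a non-zero vector of one eigenspace pairs non-trivially with a vector of the same eigenspace
  have pairing : ∀ E F : Submodule ℝ V, E ⊔ F = ⊤ → (∀ x ∈ E, ∀ y ∈ F, g.form x y = 0) →
      2 ≤ Module.finrank ℝ E → ∃ x ∈ E, ∃ y ∈ E, g.form x y ≠ 0 := by
    intro E F hEF hort hE
    have hne : E ≠ ⊥ := by
      rintro rfl
      simp at hE
    obtain ⟨x, hx, hx0⟩ := (Submodule.ne_bot_iff E).1 hne
    refine ⟨x, hx, ?_⟩
    by_contra! hcon
    refine hx0 (hnd x fun y => ?_)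
    obtain ⟨u, hu, v, hv, rfl⟩ := Submodule.mem_sup.1 (hEF ▸ Submodule.mem_top : y ∈ E ⊔ F)
    rw [map_add, hcon u hu, hort x hx v hv, add_zero]
  obtain ⟨x, hx, y, hy, hxy⟩ := pairing D₁ D₂ hsup orth hminus
  obtain ⟨x', hx', y', hy', hxy'⟩ := pairing D₂ D₁ (by rw [sup_comm, hsup])
    (fun u hu v hv => by rw [g.symm, orth v hv u hu]) hplus
  obtain ⟨a, ha, b, hb, Ja, Jb, hab⟩ :=
    exists_hyperbolic_pair hJp.sq hJp.anti_isometry D₁ inv₁ hx hy hxy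
  obtain ⟨c, hc, d, hd, Jc, Jd, hcd⟩ :=
    exists_hyperbolic_pair hJp.sq hJp.anti_isometry D₂ inv₂ hx' hy' hxy'
  have null : ∀ u, Jp u = u ∨ Jp u = -u → g.form u u = 0 := by
    intro u hu
    have h1 := hJp.anti_isometry u u
    rcases hu with hu | hu
    · rw [hu] at h1
      linarith
    · rw [hu, map_neg, map_neg, LinearMap.neg_apply, neg_neg] at h1
      linarith
  refine ⟨a, b, c, d, ⟨isNullFrame_of_products hV hab hcd (null a (.inl Ja)) (null b (.inr Jb))
    (null c (.inl Jc)) (null d (.inr Jd)) (orth a ha c hc) (orth a ha d hd) (orth b hb c hc)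
    (orth b hb d hd), Ja, Jb, Jc, Jd, ?_, ?_, ?_, ?_⟩⟩
  · rw [(mem₁ a).1 ha, Ja]
  · rw [(mem₁ b).1 hb, Jb]
  · rw [(mem₂ c).1 hc, Jc]
  · rw [(mem₂ d).1 hd, Jd, neg_neg]

/-! ### The algebraic core -/

/-- The Jacobi identity for the bracket determined by the connection coefficients in an adapted
frame `a, b, c, d`, where `αa` stands for `α(a)` and so on; the field `abc_d` is the `d`-component
of `[[a,b],c] + [[b,c],a] + [[c,a],b]` up to sign, and similarly for the others. Two of the sixteen
components repeat `abc_c` and `acd_a` and are left out. -/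
structure JacobiRelations (αa αb αc αd βa βc γb γd δa δb δc δd : ℝ) : Prop where
  abc_a : αb * αc + αc * δb + βc * γb = 0
  abc_b : -αa * αc + αb * βa + αc * δa - αd * βc + βa * δb = 0
  abc_c : -αa * δb - αb * δa + βc * γd = 0
  abc_d : βc * (αb + 2 * δb) = 0
  abd_a : αa * γb + αb * αd - αc * γd - αd * δb + γb * δa = 0
  abd_b : -αa * αd - αd * δa - βa * γd = 0
  abd_c : γd * (αa + 2 * δa) = 0
  acd_a : -αc * δd - αd * δc + βa * γb = 0
  acd_b : βa * (2 * αd + δd) = 0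
  acd_c : αd * δa + βa * γd + δa * δd = 0
  acd_d : αc * δa - αd * βc + βa * δb - βc * δd - δa * δc = 0
  bcd_a : γb * (2 * αc + δc) = 0
  bcd_c : -αc * γd - αd * δb + γb * δa - γd * δc + δb * δd = 0
  bcd_d : -αc * δb - βc * γb - δb * δc = 0

/-- The relations among the connection coefficients: the Jacobi identity together with
`ρ(a,c) = 0` and `ρ(b,d) = 0`, which express that the Ricci operator commutes with `J₊`. -/
structure CoefficientRelations (αa αb αc αd βa βc γb γd δa δb δc δd : ℝ) : Prop
    extends JacobiRelations αa αb αc αd βa βc γb γd δa δb δc δd where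
  ricci_ac : 2 * αb * βa - αc * δa - βc * δd + δa * δc = 0
  ricci_bd : -2 * αa * γb - αd * δb + γd * δc + δb * δd = 0

namespace CoefficientRelations

variable {αa αb αc αd βa βc γb γd δa δb δc δd : ℝ}

/-- The relations after the exchange of the null directions, `a ↔ b` and `c ↔ d`, under which `J₊`
and `J₋` change sign. -/
theorem swap (h : CoefficientRelations αa αb αc αd βa βc γb γd δa δb δc δd) :
    CoefficientRelations (-αb) (-αa) (-αd) (-αc) γb γd βa βc (-δb) (-δa) (-δd) (-δc) := by
  obtain ⟨⟨h1, h2, h3, h4, h5, h6, h7, h8, h9, h10, h11, h12, h13, h14⟩, h15, h16⟩ := h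
  refine ⟨?_, by linarith, by linarith⟩
  constructor <;> linarith

/-- The relations after the exchange of the two hyperbolic planes, `a ↔ c` and `b ↔ d`, under which
`J₊` is preserved and `J₋` changes sign. -/
theorem exchange (h : CoefficientRelations αa αb αc αd βa βc γb γd δa δb δc δd) :
    CoefficientRelations δc δd δa δb (-βc) (-βa) (-γd) (-γb) αc αd αa αb := by
  obtain ⟨⟨h1, h2, h3, h4, h5, h6, h7, h8, h9, h10, h11, h12, h13, h14⟩, h15, h16⟩ := h
  refine ⟨?_, by linarith, by linarith⟩
  constructor <;> linarith

/-- The equality `R(a,b,a,c) = R(c,d,a,c)`; the two sides are `-R(a,b,a,c)` and `-R(c,d,a,c)`. -/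
theorem mixed_ac (h : CoefficientRelations αa αb αc αd βa βc γb γd δa δb δc δd) :
    βa * (2 * αb + δb) = βc * (αd + 2 * δd) := by
  linarith [h.abc_b, h.acd_d, h.ricci_ac]

theorem mixed_bd (h : CoefficientRelations αa αb αc αd βa βc γb γd δa δb δc δd) :
    γb * (2 * αa + δa) = γd * (αc + 2 * δc) := by
  linarith [h.swap.mixed_ac]

/-- If `β = 0`, the curvature has no component `R(a,b,b,d)`. -/
theorem mixed_bd_of_beta_eq_zero (h : CoefficientRelations αa αb αc αd βa βc γb γd δa δb δc δd)
    (hβa : βa = 0) (hβc : βc = 0) : γb * (2 * αa + δa) = 0 := by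
  subst hβa hβc
  by_contra hne
  have hne' := hne
  rw [h.mixed_bd] at hne'
  obtain ⟨hb, -⟩ := mul_ne_zero_iff.1 hne
  obtain ⟨hd, -⟩ := mul_ne_zero_iff.1 hne'
  have e1 : δc = -2 * αc := by
    have := (mul_eq_zero.1 h.bcd_a).resolve_left hb
    linarith
  have e2 : αa = -2 * δa := by
    have := (mul_eq_zero.1 h.abd_c).resolve_left hd
    linarith
  subst e1 e2
  have h1 := h.abc_b
  have h2 : αc * δa = 0 := by linarith
  rcases mul_eq_zero.1 h2 with h3 | h3
  · exact hne' (by rw [h3]; ring)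
  · exact hne (by rw [h3]; ring)

theorem not_four (h : CoefficientRelations αa αb αc αd βa βc γb γd δa δb δc δd)
    (hβa : βa ≠ 0) (hβc : βc ≠ 0) (hγb : γb ≠ 0) (hγd : γd ≠ 0) : False := by
  have e1 : δd = -2 * αd := by linarith [(mul_eq_zero.1 h.acd_b).resolve_left hβa]
  have e2 : αb = -2 * δb := by linarith [(mul_eq_zero.1 h.abc_d).resolve_left hβc]
  have e3 : δc = -2 * αc := by linarith [(mul_eq_zero.1 h.bcd_a).resolve_left hγb]
  have e4 : αa = -2 * δa := by linarith [(mul_eq_zero.1 h.abd_c).resolve_left hγd]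
  subst e1 e2 e3 e4
  have f1 : 4 * (δa * δb) = -(βc * γd) := by linarith [h.abc_c]
  have f2 : 4 * (αc * αd) = -(βa * γb) := by linarith [h.acd_a]
  have f3 : αc * δb = βc * γb := by linarith [h.abc_a]
  have f4 : αd * δa = βa * γd := by linarith [h.abd_b]
  -- the two ways of multiplying the relations in pairs differ by a factor `16`
  have f5 : βa * γb * (βc * γd) = 0 := by
    linear_combination (1 / 15 : ℝ) * (4 * (αc * αd) * f1 - βc * γd * f2)
      - (16 / 15 : ℝ) * (αd * δa * f3 + βc * γb * f4)
  simp [hβa, hβc, hγb, hγd] at f5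

theorem not_three (h : CoefficientRelations αa αb αc αd βa βc γb γd δa δb δc δd)
    (hβa : βa = 0) (hβc : βc ≠ 0) (hγb : γb ≠ 0) (hγd : γd ≠ 0) : False := by
  subst hβa
  have e2 : αb = -2 * δb := by linarith [(mul_eq_zero.1 h.abc_d).resolve_left hβc]
  have e3 : δc = -2 * αc := by linarith [(mul_eq_zero.1 h.bcd_a).resolve_left hγb]
  have e4 : αa = -2 * δa := by linarith [(mul_eq_zero.1 h.abd_c).resolve_left hγd]
  have e1 : αd = -2 * δd := by
    have := h.mixed_ac
    have h1 : βc * (αd + 2 * δd) = 0 := by linarith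
    linarith [(mul_eq_zero.1 h1).resolve_left hβc]
  subst e1 e2 e3 e4
  have f1 : δa ≠ 0 := by
    rintro rfl
    have : βc * γd = 0 := by linarith [h.abc_c]
    simp [hβc, hγd] at this
  have f2 : αc ≠ 0 := by
    rintro rfl
    have : βc * γb = 0 := by linarith [h.abc_a]
    simp [hβc, hγb] at this
  have f3 : δd = 0 := by
    have : αc * δd = 0 := by linarith [h.acd_a]
    exact (mul_eq_zero.1 this).resolve_left f2
  subst f3
  have : αc * δa = 0 := by linarith [h.abc_b]
  simp [f1, f2] at this

/-- What the relations imply for the curvature: the mixed curvature components vanish, and so do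
`R(a,c,a,c)` and `R(b,d,b,d)`, unless `β = 0` or `γ = 0`. -/
structure VanishingPattern (αa αb αc αd βa βc γb γd δa δb δc δd : ℝ) : Prop where
  mixed_ac : βa * (2 * αb + δb) = 0
  mixed_bd : γb * (2 * αa + δa) = 0
  types : (αa * βc - 2 * αc * βa - βa * δc + 2 * βc * δa = 0 ∧
      -αb * γd + 2 * αd * γb + γb * δd - 2 * γd * δb = 0) ∨
    (βa = 0 ∧ βc = 0) ∨ (γb = 0 ∧ γd = 0)

/-- The case where `∇a` has a `d`-component only along `a`, and `∇b` a `c`-component only along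
`b`. -/
theorem vanishingPattern_of_parallel (h : CoefficientRelations αa αb αc αd βa βc γb γd δa δb δc δd)
    (hβa : βa ≠ 0) (hβc : βc = 0) (hγb : γb ≠ 0) (hγd : γd = 0) :
    VanishingPattern αa αb αc αd βa βc γb γd δa δb δc δd := by
  subst hβc hγd
  have e1 : δd = -2 * αd := by linarith [(mul_eq_zero.1 h.acd_b).resolve_left hβa]
  have e3 : δc = -2 * αc := by linarith [(mul_eq_zero.1 h.bcd_a).resolve_left hγb]
  have m1 := h.mixed_ac
  have m2 := h.mixed_bd
  rw [zero_mul] at m1 m2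
  refine ⟨m1, m2, Or.inl ⟨?_, ?_⟩⟩
  · rw [e3]; ring
  · rw [e1]; ring

/-- The case where `∇a` has a `d`-component only along `a`, and `∇b` a `c`-component only along
`d`. -/
theorem vanishingPattern_of_crossed (h : CoefficientRelations αa αb αc αd βa βc γb γd δa δb δc δd)
    (hβa : βa ≠ 0) (hβc : βc = 0) (hγb : γb = 0) (hγd : γd ≠ 0) :
    VanishingPattern αa αb αc αd βa βc γb γd δa δb δc δd := by
  subst hβc hγb
  have e1 : δd = -2 * αd := by linarith [(mul_eq_zero.1 h.acd_b).resolve_left hβa]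
  have e4 : αa = -2 * δa := by linarith [(mul_eq_zero.1 h.abd_c).resolve_left hγd]
  have m1 := h.mixed_ac
  have m2 := h.mixed_bd
  rw [zero_mul] at m1 m2
  subst e1 e4
  have f : αd * δa ≠ 0 := by
    intro h0
    have : βa * γd = 0 := by linarith [h.abd_b]
    simp [hβa, hγd] at this
  obtain ⟨fd, fa⟩ := mul_ne_zero_iff.1 f
  have f1 : αb = 2 * δb := by
    have : δa * (αb - 2 * δb) = 0 := by linarith [h.abc_c]
    linarith [(mul_eq_zero.1 this).resolve_left fa]
  have f2 : δb = 0 := by linarith [(mul_eq_zero.1 m1).resolve_left hβa]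
  have f3 : δc = 2 * αc := by
    have : αd * (δc - 2 * αc) = 0 := by linarith [h.acd_a]
    linarith [(mul_eq_zero.1 this).resolve_left fd]
  have f4 : αc = 0 := by linarith [(mul_eq_zero.1 m2.symm).resolve_left hγd]
  subst f1 f2 f3 f4
  exact ⟨by ring, by ring, Or.inl ⟨by ring, by ring⟩⟩

theorem VanishingPattern.swap
    (h : VanishingPattern (-αb) (-αa) (-αd) (-αc) γb γd βa βc (-δb) (-δa) (-δd) (-δc)) :
    VanishingPattern αa αb αc αd βa βc γb γd δa δb δc δd := by
  obtain ⟨h1, h2, h3⟩ := h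
  refine ⟨by linarith, by linarith, ?_⟩
  rcases h3 with ⟨h3, h4⟩ | h3 | h3
  · exact Or.inl ⟨by linarith, by linarith⟩
  · exact Or.inr (Or.inr h3)
  · exact Or.inr (Or.inl h3)

theorem vanishingPattern_of_exchange (h : CoefficientRelations αa αb αc αd βa βc γb γd δa δb δc δd)
    (hc : VanishingPattern δc δd δa δb (-βc) (-βa) (-γd) (-γb) αc αd αa αb) :
    VanishingPattern αa αb αc αd βa βc γb γd δa δb δc δd := by
  obtain ⟨h1, h2, h3⟩ := hc
  refine ⟨by linarith [h.mixed_ac], by linarith [h.mixed_bd], ?_⟩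
  rcases h3 with ⟨h3, h4⟩ | ⟨h3, h4⟩ | ⟨h3, h4⟩
  · exact Or.inl ⟨by linarith, by linarith⟩
  · exact Or.inr (Or.inl ⟨neg_eq_zero.1 h4, neg_eq_zero.1 h3⟩)
  · exact Or.inr (Or.inr ⟨neg_eq_zero.1 h4, neg_eq_zero.1 h3⟩)

theorem vanishingPattern (h : CoefficientRelations αa αb αc αd βa βc γb γd δa δb δc δd) :
    VanishingPattern αa αb αc αd βa βc γb γd δa δb δc δd := by
  by_cases hβ : βa = 0 ∧ βc = 0
  · exact ⟨by rw [hβ.1, zero_mul], h.mixed_bd_of_beta_eq_zero hβ.1 hβ.2, Or.inr (Or.inl hβ)⟩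
  by_cases hγ : γb = 0 ∧ γd = 0
  · exact ⟨by linarith [h.swap.mixed_bd_of_beta_eq_zero hγ.1 hγ.2], by rw [hγ.1, zero_mul],
      Or.inr (Or.inr hγ)⟩
  by_cases h1 : βa = 0
  · have h2 : βc ≠ 0 := fun h2 => hβ ⟨h1, h2⟩
    by_cases h3 : γb = 0
    · exact h.vanishingPattern_of_exchange (h.exchange.vanishingPattern_of_parallel
        (neg_ne_zero.2 h2) (neg_eq_zero.2 h1) (neg_ne_zero.2 fun h4 => hγ ⟨h3, h4⟩)
        (neg_eq_zero.2 h3))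
    by_cases h4 : γd = 0
    · exact (h.swap.vanishingPattern_of_crossed h3 h4 h1 h2).swap
    · exact (h.not_three h1 h2 h3 h4).elim
  by_cases h2 : βc = 0
  · by_cases h3 : γb = 0
    · exact h.vanishingPattern_of_crossed h1 h2 h3 fun h4 => hγ ⟨h3, h4⟩
    by_cases h4 : γd = 0
    · exact h.vanishingPattern_of_parallel h1 h2 h3 h4
    · exact (h.exchange.not_three (neg_eq_zero.2 h2) (neg_ne_zero.2 h1) (neg_ne_zero.2 h4)
        (neg_ne_zero.2 h3)).elim
  by_cases h3 : γb = 0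
  · exact (h.swap.not_three h3 (fun h4 => hγ ⟨h3, h4⟩) h1 h2).elim
  by_cases h4 : γd = 0
  · exact (h.exchange.swap.not_three (neg_eq_zero.2 h4) (neg_ne_zero.2 h3) (neg_ne_zero.2 h2)
      (neg_ne_zero.2 h1)).elim
  · exact (h.not_four h1 h2 h3 h4).elim

end CoefficientRelations

/-! ### The connection in an adapted frame -/

section Connection

variable {V : Type*} [LieRing V] [LieAlgebra ℝ V] [FiniteDimensional ℝ V]

/-- The Levi-Civita connection in a null frame, when it preserves the span of `a, d` and the span
of `b, c`: four connection forms `α, β, γ, δ`. The four vanishing values say that the planes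
spanned by `a, b` and by `c, d` are subalgebras. -/
structure IsAdaptedConnection (g : ScalarProduct V) (a b c d : V) (α β γ δ : Module.Dual ℝ V) :
    Prop extends IsNullFrame g a b c d where
  nabla_a : ∀ X, leviCivita g X a = α X • a + β X • d
  nabla_b : ∀ X, leviCivita g X b = -α X • b + γ X • c
  nabla_c : ∀ X, leviCivita g X c = δ X • c - β X • b
  nabla_d : ∀ X, leviCivita g X d = -δ X • d - γ X • a
  β_b : β b = 0
  β_d : β d = 0
  γ_a : γ a = 0
  γ_c : γ c = 0

/-- Since `∇Ω₋ = 0`, the connection preserves the eigenspaces of `J₋`; that `Ω₊` is closed gives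
the remaining conditions. -/
theorem IsAdaptedFrame.exists_connection {g : ScalarProduct V} {Jp Jm : V →ₗ[ℝ] V}
    {Ωp Ωm : TwoForm V} {a b c d : V} (h : IsAdaptedFrame g Jp Jm a b c d)
    (hJp : IsAlmostParaKahler g Jp Ωp) (hJm : IsAlmostParaKahler g Jm Ωm)
    (hpar : IsParallel g Ωm) : ∃ α β γ δ, IsAdaptedConnection g a b c d α β γ δ := by
  have hf := h.toIsNullFrame
  have met := leviCivita_metric g
  have skew : ∀ X Y, g.form (leviCivita g X Y) Y = 0 := fun X Y => by
    have := met X Y Y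
    rw [g.symm Y] at this
    linarith
  have swap : ∀ X Y Z, g.form (leviCivita g X Y) Z = -g.form (leviCivita g X Z) Y :=
    fun X Y Z => by
      have := met X Y Z
      rw [g.symm Y] at this
      linarith
  have Jskew : ∀ X Y, g.form (Jm X) Y = -g.form X (Jm Y) := fun X Y => by
    have := hJm.anti_isometry X (Jm Y)
    rwa [hJm.sq] at this
  have had : ∀ X, g.form (leviCivita g X a) d = 0 := fun X => by
    have h1 := hpar X a d
    rw [hJm.fundamental, hJm.fundamental, Jskew, h.Jm_d, h.Jm_a] at h1
    have h2 := met X a d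
    linarith
  have hbc : ∀ X, g.form (leviCivita g X b) c = 0 := fun X => by
    have h1 := hpar X b c
    rw [hJm.fundamental, hJm.fundamental, Jskew, h.Jm_c, h.Jm_b, map_neg, map_neg,
      LinearMap.neg_apply] at h1
    have h2 := met X b c
    linarith
  let α : Module.Dual ℝ V := g.form b ∘ₗ (leviCivita g).flip a
  let β : Module.Dual ℝ V := g.form c ∘ₗ (leviCivita g).flip a
  let γ : Module.Dual ℝ V := g.form d ∘ₗ (leviCivita g).flip b
  let δ : Module.Dual ℝ V := g.form d ∘ₗ (leviCivita g).flip c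
  have eα : ∀ X, g.form (leviCivita g X a) b = α X := fun X => g.symm _ _
  have eβ : ∀ X, g.form (leviCivita g X a) c = β X := fun X => g.symm _ _
  have eγ : ∀ X, g.form (leviCivita g X b) d = γ X := fun X => g.symm _ _
  have eδ : ∀ X, g.form (leviCivita g X c) d = δ X := fun X => g.symm _ _
  have na : ∀ X, leviCivita g X a = α X • a + β X • d := fun X => by
    rw [hf.expand (leviCivita g X a), eα, eβ, had, skew]
    simp
  have nb : ∀ X, leviCivita g X b = -α X • b + γ X • c := fun X => by
    rw [hf.expand (leviCivita g X b), hbc, eγ, swap X b a, eα, skew]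
    simp
  have nc : ∀ X, leviCivita g X c = δ X • c - β X • b := fun X => by
    rw [hf.expand (leviCivita g X c), swap X c b, swap X c a, hbc, eβ, eδ, skew]
    module
  have nd : ∀ X, leviCivita g X d = -δ X • d - γ X • a := fun X => by
    rw [hf.expand (leviCivita g X d), swap X d b, swap X d a, swap X d c, had, eγ, eδ, skew]
    module
  have closed := hJp.closed
  simp only [extDerivTwo, hJp.fundamental] at closed
  have c1 := closed a b c
  have c2 := closed a b d
  have c3 := closed a c d
  have c4 := closed b c d
  simp only [← leviCivita_torsionFree g, h.Jp_a, h.Jp_b, h.Jp_c, h.Jp_d, na, nb, nc, nd,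
    map_add, map_sub, map_neg, map_smul,
    LinearMap.neg_apply, LinearMap.add_apply, LinearMap.sub_apply, LinearMap.smul_apply,
    smul_eq_mul, hf.ab, hf.cd, hf.aa,
    hf.bb, hf.cc, hf.dd, hf.ac, hf.ad, hf.bc, hf.bd, hf.ba, hf.dc, hf.ca, hf.da, hf.cb,
    hf.db] at c1 c2 c3 c4
  exact ⟨α, β, γ, δ, hf, na, nb, nc, nd, by linarith, by linarith, by linarith, by linarith⟩

namespace IsAdaptedConnection

variable {g : ScalarProduct V} {a b c d : V} {α β γ δ : Module.Dual ℝ V}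

section Brackets

variable (h : IsAdaptedConnection g a b c d α β γ δ)
include h

theorem lie_ab : ⁅a, b⁆ = -α b • a - α a • b := by
  rw [← leviCivita_torsionFree g, h.nabla_a, h.nabla_b, h.β_b, h.γ_a]
  module

theorem lie_cd : ⁅c, d⁆ = -δ d • c - δ c • d := by
  rw [← leviCivita_torsionFree g, h.nabla_c, h.nabla_d, h.β_d, h.γ_c]
  module

theorem lie_ac : ⁅a, c⁆ = -α c • a - β a • b + δ a • c - β c • d := by
  rw [← leviCivita_torsionFree g, h.nabla_c, h.nabla_a]
  module

theorem lie_bc : ⁅b, c⁆ = α c • b + δ b • c := by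
  rw [← leviCivita_torsionFree g, h.nabla_c, h.nabla_b, h.β_b, h.γ_c]
  module

theorem lie_ad : ⁅a, d⁆ = -α d • a - δ a • d := by
  rw [← leviCivita_torsionFree g, h.nabla_d, h.nabla_a, h.β_d, h.γ_a]
  module

theorem lie_bd : ⁅b, d⁆ = -γ b • a + α d • b - γ d • c - δ b • d := by
  rw [← leviCivita_torsionFree g, h.nabla_d, h.nabla_b]
  module

theorem jacobi : JacobiRelations (α a) (α b) (α c) (α d) (β a) (β c) (γ b) (γ d)
    (δ a) (δ b) (δ c) (δ d) := by
  have lie_ba : ⁅b, a⁆ = α b • a + α a • b := by rw [← lie_skew, h.lie_ab]; module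
  have lie_dc : ⁅d, c⁆ = δ d • c + δ c • d := by rw [← lie_skew, h.lie_cd]; module
  have lie_ca : ⁅c, a⁆ = α c • a + β a • b - δ a • c + β c • d := by
    rw [← lie_skew, h.lie_ac]; module
  have lie_cb : ⁅c, b⁆ = -α c • b - δ b • c := by rw [← lie_skew, h.lie_bc]; module
  have lie_da : ⁅d, a⁆ = α d • a + δ a • d := by rw [← lie_skew, h.lie_ad]; module
  have lie_db : ⁅d, b⁆ = γ b • a - α d • b + γ d • c + δ b • d := by
    rw [← lie_skew, h.lie_bd]; module
  have e1 := lie_jacobi a b c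
  have e2 := lie_jacobi a b d
  have e3 := lie_jacobi a c d
  have e4 := lie_jacobi b c d
  simp only [h.lie_ab, h.lie_cd, h.lie_ac, h.lie_bc, h.lie_ad, h.lie_bd, lie_ba, lie_dc, lie_ca,
    lie_cb, lie_da, lie_db, lie_add, lie_sub, lie_smul, lie_self] at e1 e2 e3 e4
  -- the components are read off by pairing with the dual vectors `b, a, d, c`
  have pair : ∀ v : V, v = 0 →
      g.form v b = 0 ∧ g.form v a = 0 ∧ g.form v d = 0 ∧ g.form v c = 0 := by
    rintro _ rfl
    simp
  have q1 := pair _ e1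
  have q2 := pair _ e2
  have q3 := pair _ e3
  have q4 := pair _ e4
  have hf := h.toIsNullFrame
  simp only [map_add, map_sub, map_smul, map_zero, LinearMap.add_apply, LinearMap.sub_apply,
    LinearMap.smul_apply, LinearMap.zero_apply, smul_eq_mul, hf.ab, hf.cd, hf.aa, hf.bb, hf.cc,
    hf.dd, hf.ac, hf.ad, hf.bc, hf.bd, hf.ba, hf.dc, hf.ca, hf.da, hf.cb, hf.db] at q1 q2 q3 q4
  obtain ⟨a1, a2, a3, a4⟩ := q1
  obtain ⟨b1, b2, b3, b4⟩ := q2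
  obtain ⟨c1, c2, c3, c4⟩ := q3
  obtain ⟨d1, d2, d3, d4⟩ := q4
  constructor <;> linarith

/-! ### The curvature in an adapted frame -/

/-- The curvature preserves the same planes as the connection: its four component two-forms are
given by the structure equations of the connection forms. -/
theorem curv_a (X Y : V) : curv g X Y a =
    (α ⁅X, Y⁆ - β X * γ Y + β Y * γ X) • a
      + (β ⁅X, Y⁆ + β Y * (α X + δ X) - β X * (α Y + δ Y)) • d := by
  simp only [curv, LinearMap.mk₂_apply, LinearMap.sub_apply, LinearMap.comp_apply, h.nabla_a,
    h.nabla_d, map_add, map_smul]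
  module

theorem curv_b (X Y : V) : curv g X Y b =
    -(α ⁅X, Y⁆ - β X * γ Y + β Y * γ X) • b
      + (γ ⁅X, Y⁆ + γ X * (α Y + δ Y) - γ Y * (α X + δ X)) • c := by
  simp only [curv, LinearMap.mk₂_apply, LinearMap.sub_apply, LinearMap.comp_apply, h.nabla_b,
    h.nabla_c, map_add, map_smul]
  module

theorem curv_c (X Y : V) : curv g X Y c =
    (δ ⁅X, Y⁆ - β X * γ Y + β Y * γ X) • c
      - (β ⁅X, Y⁆ + β Y * (α X + δ X) - β X * (α Y + δ Y)) • b := by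
  simp only [curv, LinearMap.mk₂_apply, LinearMap.sub_apply, LinearMap.comp_apply, h.nabla_b,
    h.nabla_c, map_sub, map_smul]
  module

theorem curv_d (X Y : V) : curv g X Y d =
    -(δ ⁅X, Y⁆ - β X * γ Y + β Y * γ X) • d
      - (γ ⁅X, Y⁆ + γ X * (α Y + δ Y) - γ Y * (α X + δ X)) • a := by
  simp only [curv, LinearMap.mk₂_apply, LinearMap.sub_apply, LinearMap.comp_apply, h.nabla_a,
    h.nabla_d, map_sub, map_smul]
  module

end Brackets

end IsAdaptedConnection
end Connection

section ReducedCurvature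

variable {V : Type*} [LieRing V] [LieAlgebra ℝ V] [FiniteDimensional ℝ V]

theorem curv_skew (g : ScalarProduct V) (X Y : V) : curv g Y X = -curv g X Y := by
  ext Z
  simp only [curv, LinearMap.mk₂_apply, LinearMap.sub_apply, LinearMap.neg_apply]
  rw [← lie_skew X Y, map_neg, LinearMap.neg_apply]
  abel

theorem curv_self (g : ScalarProduct V) (X : V) : curv g X X = 0 := by
  ext Z
  simp [curv]

theorem ricci_nullFrame {g : ScalarProduct V} {e : Module.Basis (Fin 4) ℝ V}
    (he : IsOrthonormalBasis g e) {a b c d : V} (h : IsNullFrame g a b c d) (X Y : V) :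
    ricci g X Y = g.form (curv g X a Y) b + g.form (curv g X b Y) a
      + g.form (curv g X c Y) d + g.form (curv g X d Y) c := by
  rw [ricci, LinearMap.mk₂_apply, trace_eq_nullFrame he h]
  rfl

/-- The curvature of an adapted frame, once the Jacobi identity and the `J₊`-invariance of the
Ricci operator are taken into account. The parameters are `k = R(a,b,a,b)`, `l = R(c,d,c,d)`,
`t = R(a,b,c,d) = R(a,c,b,d)`, `p = R(a,c,a,c)` and `q = R(b,d,b,d)`. -/
structure HasReducedCurvature (g : ScalarProduct V) (a b c d : V) (k l t p q : ℝ) : Prop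
    extends IsNullFrame g a b c d where
  ab_a : curv g a b a = k • a
  ab_b : curv g a b b = -k • b
  ab_c : curv g a b c = t • c
  ab_d : curv g a b d = -t • d
  cd_a : curv g c d a = t • a
  cd_b : curv g c d b = -t • b
  cd_c : curv g c d c = l • c
  cd_d : curv g c d d = -l • d
  ac_a : curv g a c a = p • d
  ac_b : curv g a c b = t • c
  ac_c : curv g a c c = -p • b
  ac_d : curv g a c d = -t • a
  bd_a : curv g b d a = t • d
  bd_b : curv g b d b = q • c
  bd_c : curv g b d c = -t • b
  bd_d : curv g b d d = -q • a
  curv_ad : curv g a d = 0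
  curv_bc : curv g b c = 0

theorem IsAdaptedConnection.coefficientRelations {g : ScalarProduct V} {a b c d : V}
    {α β γ δ : Module.Dual ℝ V} (h : IsAdaptedConnection g a b c d α β γ δ)
    {e : Module.Basis (Fin 4) ℝ V} (he : IsOrthonormalBasis g e) (hac : ricci g a c = 0)
    (hbd : ricci g b d = 0) :
    CoefficientRelations (α a) (α b) (α c) (α d) (β a) (β c) (γ b) (γ d)
      (δ a) (δ b) (δ c) (δ d) := by
  have hf := h.toIsNullFrame
  rw [ricci_nullFrame he hf] at hac hbd
  simp only [curv_self, curv_skew g a b, h.curv_c, h.curv_d, h.lie_ab,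
    h.lie_ac, h.lie_bc, h.lie_ad, h.lie_bd, h.β_b, h.β_d, h.γ_a, h.γ_c, map_add, map_sub, map_neg,
    map_smul, map_zero, LinearMap.sub_apply, LinearMap.neg_apply,
    LinearMap.smul_apply, LinearMap.zero_apply, smul_eq_mul, hf.ab, hf.cd, hf.cc,
    hf.dd, hf.ac, hf.ad, hf.bc, hf.bd, hf.ba, hf.dc, hf.ca, hf.db] at hac hbd
  exact ⟨h.jacobi, by linarith, by linarith⟩

theorem IsAdaptedConnection.exists_reducedCurvature {g : ScalarProduct V} {a b c d : V}
    {α β γ δ : Module.Dual ℝ V} (h : IsAdaptedConnection g a b c d α β γ δ)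
    {e : Module.Basis (Fin 4) ℝ V} (he : IsOrthonormalBasis g e) (hac : ricci g a c = 0)
    (hbd : ricci g b d = 0) :
    ∃ k l t p q, HasReducedCurvature g a b c d k l t p q ∧
      ((p = 0 ∧ q = 0) ∨ (t = 0 ∧ (p = 0 ∨ q = 0))) := by
  have rel := h.coefficientRelations he hac hbd
  have hβb := h.β_b
  have hβd := h.β_d
  have hγa := h.γ_a
  have hγc := h.γ_c
  obtain ⟨m1, m2, types⟩ := rel.vanishingPattern
  have m3 := rel.mixed_ac
  have m4 := rel.mixed_bd
  obtain ⟨⟨j1, j2, j3, j4, j5, j6, j7, j8, j9, j10, j11, j12, j13, j14⟩, r1, r2⟩ := rel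
  refine ⟨-2 * α a * α b - β a * γ b, -2 * δ c * δ d - β c * γ d, -β a * γ b - β c * γ d,
    α a * β c - 2 * α c * β a - β a * δ c + 2 * β c * δ a,
    -α b * γ d + 2 * α d * γ b + γ b * δ d - 2 * γ d * δ b,
    ⟨h.toIsNullFrame, ?_, ?_, ?_, ?_, ?_, ?_, ?_, ?_, ?_, ?_, ?_, ?_, ?_, ?_, ?_, ?_,
      h.hom_ext ?_ ?_ ?_ ?_, h.hom_ext ?_ ?_ ?_ ?_⟩, ?_⟩
  case refine_25 =>
    rcases types with ⟨hp, hq⟩ | ⟨h1, h2⟩ | ⟨h1, h2⟩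
    · exact Or.inl ⟨hp, hq⟩
    · exact Or.inr ⟨by rw [h1, h2]; ring, Or.inl (by rw [h1, h2]; ring)⟩
    · exact Or.inr ⟨by rw [h1, h2]; ring, Or.inr (by rw [h1, h2]; ring)⟩
  all_goals
    simp only [h.curv_a, h.curv_b, h.curv_c, h.curv_d, h.lie_ab, h.lie_cd, h.lie_ac, h.lie_bc,
      h.lie_ad, h.lie_bd, LinearMap.zero_apply, map_add, map_sub, map_smul, smul_eq_mul, hβb, hβd,
      hγa, hγc]
    match_scalars <;> linarith

end ReducedCurvature

/-! ### The Weyl operators in an adapted frame -/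

section Weyl

variable {V : Type*} [LieRing V] [LieAlgebra ℝ V] [FiniteDimensional ℝ V]

theorem form_ricciOp (g : ScalarProduct V) (X Y : V) :
    g.form (ricciOp g X) Y = ricci g X Y := by
  simp [ricciOp, LinearMap.BilinForm.apply_toDual_symm_apply]

theorem weylBilin_apply (g : ScalarProduct V) (x y z w : V) :
    weylBilin g x y z w = g.form (curv g x y z) w
      - 1 / 2 * (ricci g x z * g.form y w + g.form x z * ricci g y w
        - ricci g y z * g.form x w - g.form y z * ricci g x w)
      + scalarCurv g / 6 * (g.form x z * g.form y w - g.form y z * g.form x w) := by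
  simp [weylBilin]

theorem weylOp_nullFrame {g : ScalarProduct V} {e : Module.Basis (Fin 4) ℝ V}
    (he : IsOrthonormalBasis g e) {a b c d : V} (h : IsNullFrame g a b c d) (α : TwoForm V)
    (z w : V) :
    weylOp g e α ![z, w] = -α ![a, b] * weylBilin g a b z w - α ![c, d] * weylBilin g c d z w
      + α ![a, c] * weylBilin g b d z w + α ![b, d] * weylBilin g a c z w
      + α ![a, d] * weylBilin g b c z w + α ![b, c] * weylBilin g a d z w := by
  let B : LinearMap.BilinForm ℝ V := LinearMap.mk₂ ℝ (fun x y => weylBilin g x y z w)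
    (fun x x' y => by simp only [weylBilin_apply, map_add, LinearMap.add_apply]; ring)
    (fun r x y => by
      simp only [weylBilin_apply, map_smul, LinearMap.smul_apply, smul_eq_mul]; ring)
    (fun x y y' => by simp only [weylBilin_apply, map_add, LinearMap.add_apply]; ring)
    (fun r x y => by
      simp only [weylBilin_apply, map_smul, LinearMap.smul_apply, smul_eq_mul]; ring)
  have hB : ∀ x y, B x y = weylBilin g x y z w := fun x y => rfl
  have skew : ∀ x y, B x y = -B y x := fun x y => by
    simp only [hB, weylBilin_apply, curv_skew g y x, LinearMap.neg_apply, map_neg]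
    ring
  have expand : weylOp g e α ![z, w] = (1 / 2 : ℝ) * ∑ i, ∑ j,
      g.form (e i) (e i) * g.form (e j) (e j) * α.toBilin (e i) (e j) * B (e i) (e j) := by
    simp only [weylOp, LinearMap.coe_mk, AddHom.coe_mk, AlternatingMap.smul_apply,
      twoForm_sum_apply, smul_eq_mul]
    rfl
  rw [expand, sum_sum_orthonormal_eq_nullFrame he h]
  simp only [← hB, TwoForm.toBilin_apply, TwoForm.self, α.skew b a, α.skew c a, α.skew d a,
    α.skew c b, α.skew d b, α.skew d c, skew b a, skew c a, skew d a, skew c b, skew d b, skew d c]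
  ring

namespace HasReducedCurvature

variable {g : ScalarProduct V} {a b c d : V} {k l t p q : ℝ}
  (h : HasReducedCurvature g a b c d k l t p q)
  {e : Module.Basis (Fin 4) ℝ V} (he : IsOrthonormalBasis g e)
include h he

/-- The Ricci tensor has the two independent components `ρ(a,b) = t - k` and `ρ(c,d) = t - l`. -/
theorem ricci_values :
    (ricci g a a = 0 ∧ ricci g b b = 0 ∧ ricci g c c = 0 ∧ ricci g d d = 0) ∧
    (ricci g a b = t - k ∧ ricci g b a = t - k ∧ ricci g c d = t - l ∧ ricci g d c = t - l) ∧
    (ricci g a c = 0 ∧ ricci g c a = 0 ∧ ricci g a d = 0 ∧ ricci g d a = 0) ∧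
    (ricci g b c = 0 ∧ ricci g c b = 0 ∧ ricci g b d = 0 ∧ ricci g d b = 0) := by
  have hf := h.toIsNullFrame
  simp only [ricci_nullFrame he hf, curv_self, curv_skew g a b, curv_skew g a c, curv_skew g a d,
    curv_skew g b c, curv_skew g b d, curv_skew g c d, h.ab_a, h.ab_b, h.ab_c, h.ab_d, h.cd_a,
    h.cd_b, h.cd_c, h.cd_d, h.ac_a, h.ac_b, h.ac_c, h.ac_d, h.bd_a, h.bd_b, h.bd_c, h.bd_d,
    h.curv_ad, h.curv_bc, LinearMap.neg_apply, LinearMap.zero_apply, map_neg, map_zero, map_smul,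
    LinearMap.smul_apply, smul_eq_mul, hf.ab, hf.cd, hf.aa,
    hf.bb, hf.cc, hf.dd, hf.ac, hf.ad, hf.bc, hf.bd, hf.ba, hf.dc, hf.ca, hf.da, hf.cb, hf.db]
  ring_nf
  simp

theorem scalarCurv_eq : scalarCurv g = 2 * (2 * t - k - l) := by
  obtain ⟨-, ⟨h1, h2, h3, h4⟩, -, -⟩ := h.ricci_values he
  rw [scalarCurv, trace_eq_nullFrame he h.toIsNullFrame]
  simp only [form_ricciOp, h1, h2, h3, h4]
  ring

/-- The components of `W(α)`; here `τ` is the scalar curvature. -/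
theorem weylOp_values (α : TwoForm V) :
    weylOp g e α ![a, b] =
      -(t - scalarCurv g / 6) * α ![a, b] - t * α ![c, d] ∧
    weylOp g e α ![c, d] =
      -t * α ![a, b] - (t - scalarCurv g / 6) * α ![c, d] ∧
    weylOp g e α ![a, c] = (t - scalarCurv g / 12) * α ![a, c] + p * α ![b, d] ∧
    weylOp g e α ![b, d] = (t - scalarCurv g / 12) * α ![b, d] + q * α ![a, c] ∧
    weylOp g e α ![a, d] = -(scalarCurv g / 12) * α ![a, d] ∧
    weylOp g e α ![b, c] = -(scalarCurv g / 12) * α ![b, c] := by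
  have hf := h.toIsNullFrame
  obtain ⟨⟨r1, r2, r3, r4⟩, ⟨r5, r6, r7, r8⟩, ⟨r9, r10, r11, r12⟩, ⟨r13, r14, r15, r16⟩⟩ :=
    h.ricci_values he
  have hs := h.scalarCurv_eq he
  simp only [weylOp_nullFrame he hf, weylBilin_apply, h.ab_a, h.ab_b, h.ab_c, h.cd_a,
    h.cd_b, h.cd_c, h.ac_a, h.ac_b, h.ac_c, h.bd_a, h.bd_b, h.bd_c, 
    h.curv_ad, h.curv_bc, LinearMap.zero_apply, map_zero, map_smul,
    LinearMap.smul_apply, smul_eq_mul, hf.ab, hf.cd, hf.aa, hf.bb, hf.cc, hf.dd, hf.ac, hf.ad,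
    hf.bc, hf.bd, hf.ba, hf.dc, hf.ca, hf.da, hf.cb, hf.db, r1, r2, r3, r4, r5, r6, r7, r8, r9,
    r10, r11, r12, r13, r14, r15, r16, hs]
  refine ⟨?_, ?_, ?_, ?_, ?_, ?_⟩ <;> ring

/-- For the orientation with `vol(a,b,c,d) = -1`: the components of `W⁺(α)`. -/
theorem weylPlus_values (ho : e.det ![a, b, c, d] = -1) (α : TwoForm V) :
    weylPlus g e α ![a, b] = (scalarCurv g / 12 - t) * (α ![a, b] + α ![c, d]) ∧
    weylPlus g e α ![c, d] = (scalarCurv g / 12 - t) * (α ![a, b] + α ![c, d]) ∧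
    weylPlus g e α ![a, c] = -(scalarCurv g / 12 - t) * α ![a, c] + p * α ![b, d] ∧
    weylPlus g e α ![b, d] = -(scalarCurv g / 12 - t) * α ![b, d] + q * α ![a, c] ∧
    weylPlus g e α ![a, d] = 0 ∧
    weylPlus g e α ![b, c] = 0 := by
  obtain ⟨w1, w2, w3, w4, w5, w6⟩ := h.weylOp_values he α
  obtain ⟨s1, s2, s3, s4, s5, s6⟩ := hodgeStar_nullFrame he h.toIsNullFrame (weylOp g e α)
  simp only [weylPlus, LinearMap.smul_apply, LinearMap.add_apply, Module.End.mul_apply,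
    AlternatingMap.smul_apply, AlternatingMap.add_apply, smul_eq_mul, s1, s2, s3, s4, s5, s6,
    w1, w2, w3, w4, w5, w6, ho]
  refine ⟨?_, ?_, ?_, ?_, ?_, ?_⟩ <;> ring

/-- For the orientation with `vol(a,b,c,d) = -1`: the components of `W⁻(α)`. -/
theorem weylMinus_values (ho : e.det ![a, b, c, d] = -1) (α : TwoForm V) :
    weylMinus g e α ![a, b] = scalarCurv g / 12 * (α ![a, b] - α ![c, d]) ∧
    weylMinus g e α ![c, d] = -(scalarCurv g / 12) * (α ![a, b] - α ![c, d]) ∧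
    weylMinus g e α ![a, c] = 0 ∧
    weylMinus g e α ![b, d] = 0 ∧
    weylMinus g e α ![a, d] = -(scalarCurv g / 12) * α ![a, d] ∧
    weylMinus g e α ![b, c] = -(scalarCurv g / 12) * α ![b, c] := by
  obtain ⟨w1, w2, w3, w4, w5, w6⟩ := h.weylOp_values he α
  obtain ⟨s1, s2, s3, s4, s5, s6⟩ := hodgeStar_nullFrame he h.toIsNullFrame (weylOp g e α)
  simp only [weylMinus, LinearMap.smul_apply, LinearMap.sub_apply, Module.End.mul_apply,
    AlternatingMap.smul_apply, AlternatingMap.sub_apply, smul_eq_mul, s1, s2, s3, s4, s5, s6,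
    w1, w2, w3, w4, w5, w6, ho]
  refine ⟨?_, ?_, ?_, ?_, ?_, ?_⟩ <;> ring

end HasReducedCurvature

end Weyl

/-! ### Algebraic types of endomorphisms -/

section Types

open Polynomial

variable {M : Type*} [AddCommGroup M] [Module ℝ M] {f : Module.End ℝ M}

theorem aeval_apply_eigenvector {μ : ℝ} {v : M} (hv : f v = μ • v) (P : ℝ[X]) :
    aeval f P v = P.eval μ • v := by
  by_cases h0 : v = 0
  · simp [h0]
  · exact Module.End.aeval_apply_of_hasEigenvector ⟨Module.End.mem_eigenspace_iff.2 hv, h0⟩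

/-- The minimal polynomial of a diagonalizable endomorphism has no multiple root. -/
theorem IsDiagonalizable.rootMultiplicity_ne_two (hf : IsDiagonalizable f) (μ : ℝ) :
    (minpoly ℝ f).rootMultiplicity μ ≠ 2 := by
  intro hμ
  have h0 : minpoly ℝ f ≠ 0 := by
    intro h
    simp [h] at hμ
  obtain ⟨Q, hQ⟩ := pow_rootMultiplicity_dvd (minpoly ℝ f) μ
  rw [hμ] at hQ
  -- removing one factor `X - μ` still gives an annihilating polynomial
  have hann : aeval f ((X - C μ) * Q) = 0 := by
    have hle : ⨆ ν : ℝ, f.eigenspace ν ≤ LinearMap.ker (aeval f ((X - C μ) * Q)) := by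
      refine iSup_le fun ν v hv => ?_
      rw [Module.End.mem_eigenspace_iff] at hv
      rw [LinearMap.mem_ker, aeval_apply_eigenvector hv]
      have h1 := aeval_apply_eigenvector hv (minpoly ℝ f)
      rw [minpoly.aeval, LinearMap.zero_apply, hQ] at h1
      rcases smul_eq_zero.1 h1.symm with h2 | h2
      · have h3 : eval ν ((X - C μ) * Q) = 0 := by
          simp only [eval_mul, eval_pow, eval_sub, eval_X, eval_C] at h2 ⊢
          rcases mul_eq_zero.1 h2 with h3 | h3
          · rw [pow_eq_zero_iff two_ne_zero |>.1 h3, zero_mul]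
          · rw [h3, mul_zero]
        rw [h3, zero_smul]
      · rw [h2, smul_zero]
    rw [hf, top_le_iff, LinearMap.ker_eq_top] at hle
    exact hle
  have hdvd := minpoly.dvd ℝ f hann
  have hQ0 : Q ≠ 0 := by
    rintro rfl
    exact h0 (by rw [hQ, mul_zero])
  have hX : (X - C μ) ≠ 0 := X_sub_C_ne_zero μ
  have hdeg := natDegree_le_of_dvd hdvd (mul_ne_zero hX hQ0)
  rw [hQ, natDegree_mul (pow_ne_zero 2 hX) hQ0, natDegree_mul hX hQ0, natDegree_pow,
    natDegree_X_sub_C] at hdeg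
  omega

theorem IsDiagonalizable.eq_zero_of_sq_eq_zero (hf : IsDiagonalizable f) (h : f ^ 2 = 0) :
    f = 0 := by
  have hle : ⨆ ν : ℝ, f.eigenspace ν ≤ LinearMap.ker f := by
    refine iSup_le fun ν v hv => ?_
    rw [Module.End.mem_eigenspace_iff] at hv
    have h1 : f (f v) = 0 := by rw [← Module.End.mul_apply, ← sq, h, LinearMap.zero_apply]
    rw [hv, map_smul, hv, smul_smul] at h1
    rw [LinearMap.mem_ker, hv]
    rcases smul_eq_zero.1 h1 with h2 | h2
    · rw [mul_self_eq_zero.1 h2, zero_smul]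
    · rw [h2, smul_zero]
  rw [hf, top_le_iff, LinearMap.ker_eq_top] at hle
  exact hle

theorem rootMultiplicity_minpoly_of_sq_eq_zero (h : f ^ 2 = 0) {μ : ℝ} (hμ : μ ≠ 0) :
    (minpoly ℝ f).rootMultiplicity μ = 0 := by
  have hdvd : minpoly ℝ f ∣ X ^ 2 := minpoly.dvd ℝ f (by rw [map_pow, aeval_X, h])
  apply rootMultiplicity_eq_zero
  intro hroot
  have := hroot.dvd hdvd
  simp [hμ] at this

/-- A Jordan chain of length two for `μ` together with an annihilating polynomial in which `μ` is
a double root: then `μ` is a double root of the minimal polynomial. -/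
theorem rootMultiplicity_minpoly_eq_two {μ : ℝ} {v w : M} (hv : f v = μ • v + w)
    (hw : f w = μ • w) (hw0 : w ≠ 0) {Q : ℝ[X]} (hQ : Q.eval μ ≠ 0)
    (hann : aeval f ((X - C μ) ^ 2 * Q) = 0) : (minpoly ℝ f).rootMultiplicity μ = 2 := by
  have hQ0 : Q ≠ 0 := by
    rintro rfl
    simp at hQ
  have hP0 : (X - C μ) ^ 2 * Q ≠ 0 := mul_ne_zero (pow_ne_zero 2 (X_sub_C_ne_zero μ)) hQ0
  have hdvd := minpoly.dvd ℝ f hann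
  have h0 : minpoly ℝ f ≠ 0 := ne_zero_of_dvd_ne_zero hP0 hdvd
  apply le_antisymm
  · refine (rootMultiplicity_le_rootMultiplicity_of_dvd hP0 hdvd μ).trans ?_
    rw [rootMultiplicity_mul hP0, rootMultiplicity_X_sub_C_pow,
      rootMultiplicity_eq_zero (p := Q) hQ]
  · by_contra hlt
    obtain ⟨R, hR, hRμ⟩ := exists_eq_pow_rootMultiplicity_mul_and_not_dvd (minpoly ℝ f) h0 μ
    rw [dvd_iff_isRoot, IsRoot.def] at hRμ
    -- otherwise `(X - μ) R` annihilates `f`, although it maps `v` to a multiple of `w`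
    have hann' : aeval f (R * (X - C μ)) = 0 := by
      have hd : minpoly ℝ f ∣ R * (X - C μ) := by
        rw [mul_comm]
        nth_rw 1 [hR]
        refine mul_dvd_mul_right ?_ R
        have : (minpoly ℝ f).rootMultiplicity μ ≤ 1 := by omega
        simpa using pow_dvd_pow (X - C μ) this
      obtain ⟨S, hS⟩ := hd
      rw [hS, map_mul, minpoly.aeval, zero_mul]
    have h1 : aeval f (R * (X - C μ)) v = R.eval μ • w := by
      rw [map_mul, Module.End.mul_apply, map_sub, aeval_X, aeval_C, LinearMap.sub_apply,
        Module.algebraMap_end_apply, hv, add_sub_cancel_left, aeval_apply_eigenvector hw]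
    rw [hann', LinearMap.zero_apply] at h1
    exact (smul_ne_zero hRμ hw0) h1.symm

end Types

/-! ### The type of the Weyl operators -/

section Frame

variable {V : Type*} [AddCommGroup V] [Module ℝ V]

/-- An endomorphism of `Λ²` that is diagonal in a null frame, except that it may mix `a* ∧ b*` and
`c* ∧ d*` symmetrically, is diagonalizable. -/
theorem isDiagonalizable_of_values {g : ScalarProduct V} {a b c d : V}
    (h : IsNullFrame g a b c d) {f : Module.End ℝ (TwoForm V)} {x y r s t u : ℝ}
    (hf : ∀ α, f α ![a, b] = x * α ![a, b] + y * α ![c, d] ∧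
      f α ![c, d] = y * α ![a, b] + x * α ![c, d] ∧
      f α ![a, c] = r * α ![a, c] ∧ f α ![b, d] = s * α ![b, d] ∧
      f α ![a, d] = t * α ![a, d] ∧ f α ![b, c] = u * α ![b, c]) : IsDiagonalizable f := by
  have mem : ∀ (μ : ℝ) (θ : TwoForm V),
      f θ ![a, b] = μ * θ ![a, b] → f θ ![c, d] = μ * θ ![c, d] → f θ ![a, c] = μ * θ ![a, c] →
      f θ ![b, d] = μ * θ ![b, d] → f θ ![a, d] = μ * θ ![a, d] → f θ ![b, c] = μ * θ ![b, c] →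
      θ ∈ ⨆ ν : ℝ, f.eigenspace ν := by
    intro μ θ h1 h2 h3 h4 h5 h6
    refine Submodule.mem_iSup_of_mem μ (Module.End.mem_eigenspace_iff.2 ?_)
    apply TwoForm.ext_nullFrame h <;> simpa
  rw [IsDiagonalizable, eq_top_iff]
  intro α _
  have hα : α = ((α ![a, b] + α ![c, d]) / 2) •
        (wedgeDual (g.form b) (g.form a) + wedgeDual (g.form d) (g.form c))
      + ((α ![a, b] - α ![c, d]) / 2) •
        (wedgeDual (g.form b) (g.form a) - wedgeDual (g.form d) (g.form c))
      + α ![a, c] • wedgeDual (g.form b) (g.form d) + α ![b, d] • wedgeDual (g.form a) (g.form c)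
      + α ![a, d] • wedgeDual (g.form b) (g.form c)
      + α ![b, c] • wedgeDual (g.form a) (g.form d) := by
    apply TwoForm.ext_nullFrame h <;>
    · simp only [AlternatingMap.add_apply, AlternatingMap.sub_apply, AlternatingMap.smul_apply,
        smul_eq_mul, wedgeDual_apply, h.ab, h.cd, h.aa, h.bb, h.cc, h.dd, h.ac, h.ad,
        h.bc, h.bd, h.ba, h.dc, h.ca, h.da, h.cb, h.db]
      ring
  rw [hα]
  refine Submodule.add_mem _ (Submodule.add_mem _ (Submodule.add_mem _ (Submodule.add_mem _
    (Submodule.add_mem _ (Submodule.smul_mem _ _ (mem (x + y) _ ?_ ?_ ?_ ?_ ?_ ?_))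
    (Submodule.smul_mem _ _ (mem (x - y) _ ?_ ?_ ?_ ?_ ?_ ?_)))
    (Submodule.smul_mem _ _ (mem r _ ?_ ?_ ?_ ?_ ?_ ?_)))
    (Submodule.smul_mem _ _ (mem s _ ?_ ?_ ?_ ?_ ?_ ?_)))
    (Submodule.smul_mem _ _ (mem t _ ?_ ?_ ?_ ?_ ?_ ?_)))
    (Submodule.smul_mem _ _ (mem u _ ?_ ?_ ?_ ?_ ?_ ?_))
  all_goals
    simp only [(hf _).1, (hf _).2.1, (hf _).2.2.1, (hf _).2.2.2.1, (hf _).2.2.2.2.1,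
      (hf _).2.2.2.2.2, AlternatingMap.add_apply, AlternatingMap.sub_apply, wedgeDual_apply, h.ab,
      h.cd, h.aa, h.bb, h.cc, h.dd, h.ac, h.ad, h.bc, h.bd, h.ba, h.dc, h.ca, h.da, h.cb, h.db] <;>
    ring

/-- The values of an endomorphism of `Λ²` in the shape of `W⁺` with `R(a,c,a,c) = 0`. -/
structure HasJordanValues (f : Module.End ℝ (TwoForm V)) (a b c d : V) (κ q : ℝ) : Prop where
  ab : ∀ α, f α ![a, b] = κ * (α ![a, b] + α ![c, d])
  cd : ∀ α, f α ![c, d] = κ * (α ![a, b] + α ![c, d])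
  ac : ∀ α, f α ![a, c] = -κ * α ![a, c]
  bd : ∀ α, f α ![b, d] = -κ * α ![b, d] + q * α ![a, c]
  ad : ∀ α, f α ![a, d] = 0
  bc : ∀ α, f α ![b, c] = 0

namespace HasJordanValues

variable {g : ScalarProduct V} {a b c d : V} {f : Module.End ℝ (TwoForm V)} {κ q : ℝ}

open Polynomial in
/-- The Jordan block: `a* ∧ c*` is mapped to `-κ a* ∧ c* + q b* ∧ d*`. -/
theorem double_root (hf : HasJordanValues f a b c d κ q) (h : IsNullFrame g a b c d) (hκ : κ ≠ 0)
    (hq : q ≠ 0) : (minpoly ℝ f).rootMultiplicity (-κ) = 2 := by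
  refine rootMultiplicity_minpoly_eq_two (v := wedgeDual (g.form b) (g.form d))
    (w := q • wedgeDual (g.form a) (g.form c)) (Q := X * (X - C (2 * κ))) ?_ ?_ ?_ ?_ ?_
  · apply TwoForm.ext_nullFrame h <;>
    simp only [hf.ab, hf.cd, hf.ac, hf.bd, hf.ad, hf.bc, AlternatingMap.add_apply,
      AlternatingMap.smul_apply, smul_eq_mul, wedgeDual_apply, h.ab, h.cd, h.aa, h.bb, h.cc, h.dd,
      h.ac, h.ad, h.bc, h.bd, h.ba, h.dc, h.ca, h.da, h.cb, h.db] <;>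
    ring
  · apply TwoForm.ext_nullFrame h <;>
    simp only [hf.ab, hf.cd, hf.ac, hf.bd, hf.ad, hf.bc, AlternatingMap.smul_apply, smul_eq_mul,
      wedgeDual_apply, h.ab, h.cd, h.aa, h.cc, h.ac, h.ad, h.ca, h.cb] <;>
    ring
  · intro h0
    have := congrArg (fun θ : TwoForm V => θ ![b, d]) h0
    simp [wedgeDual_apply, h.ab, h.cd, h.ad, h.cb, hq] at this
  · have : (-κ) * (-κ - 2 * κ) ≠ 0 := by
      have : (-κ) * (-κ - 2 * κ) = 3 * κ ^ 2 := by ring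
      rw [this]
      positivity
    simpa using this
  · ext1 α
    rw [map_mul, map_pow, map_mul, map_sub, map_sub, aeval_X, aeval_C, aeval_C]
    apply TwoForm.ext_nullFrame h <;>
    · simp only [sq, Module.End.mul_apply, LinearMap.sub_apply, Module.algebraMap_end_apply,
        LinearMap.zero_apply, AlternatingMap.zero_apply, AlternatingMap.sub_apply,
        AlternatingMap.smul_apply, smul_eq_mul, hf.ab, hf.cd, hf.ac, hf.bd, hf.ad, hf.bc]
      ring

theorem sq_eq_zero (hf : HasJordanValues f a b c d 0 q) (h : IsNullFrame g a b c d) :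
    f ^ 2 = 0 := by
  ext1 α
  apply TwoForm.ext_nullFrame h <;>
  simp [sq, hf.ab, hf.cd, hf.ac, hf.bd, hf.ad, hf.bc]

theorem ne_zero (hf : HasJordanValues f a b c d κ q) (h : IsNullFrame g a b c d) (hq : q ≠ 0) :
    f ≠ 0 := by
  rintro rfl
  have := hf.bd (wedgeDual (g.form b) (g.form d))
  simp [wedgeDual_apply, h.ba, h.dc, h.bb, h.da, h.bc, h.db, hq.symm] at this

end HasJordanValues

end Frame

section WeylType

variable {V : Type*} [LieRing V] [LieAlgebra ℝ V] [FiniteDimensional ℝ V]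

theorem weylOp_eq_zero_of_flat {g : ScalarProduct V} (e : Module.Basis (Fin 4) ℝ V)
    (h : curv g = 0) : weylOp g e = 0 := by
  have hr : ricci g = 0 := by
    ext X Y
    have : (curv g X).flip Y = 0 := by
      ext Z
      simp [h]
    rw [ricci, LinearMap.mk₂_apply, this]
    simp
  have hs : scalarCurv g = 0 := by simp [scalarCurv, ricciOp, hr]
  have hw : ∀ x y, weyl g x y = 0 := fun x y => by
    ext v
    simp [weyl, twoFormOfBilin, weylBilin_apply, h, hr, hs]
  ext1 α
  simp [weylOp, hw]

theorem CaseTwoStepNilpotent.of_weyl {g : ScalarProduct V} {e : Module.Basis (Fin 4) ℝ V}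
    (h1 : weylMinus g e = 0) (h2 : weylPlus g e ≠ 0) (h3 : weylPlus g e ^ 2 = 0) :
    CaseTwoStepNilpotent g e := by
  refine ⟨h1, h2, h3, fun h => h2 ?_⟩
  rw [weylPlus, weylOp_eq_zero_of_flat e h]
  simp

/-- The three types exclude each other. -/
theorem exactly_one_of_some {g : ScalarProduct V} {e : Module.Basis (Fin 4) ℝ V}
    (h : CaseDiagonalizable g e ∨ CaseDoubleRoot g e ∨ CaseTwoStepNilpotent g e) :
    (CaseDiagonalizable g e ∧ ¬CaseDoubleRoot g e ∧ ¬CaseTwoStepNilpotent g e) ∨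
      (¬CaseDiagonalizable g e ∧ CaseDoubleRoot g e ∧ ¬CaseTwoStepNilpotent g e) ∨
      (¬CaseDiagonalizable g e ∧ ¬CaseDoubleRoot g e ∧ CaseTwoStepNilpotent g e) := by
  have h12 : CaseDiagonalizable g e → ¬CaseDoubleRoot g e := fun h1 ⟨μ, _, h2⟩ =>
    h1.1.rootMultiplicity_ne_two μ h2
  have h13 : CaseDiagonalizable g e → ¬CaseTwoStepNilpotent g e := fun h1 h3 =>
    h3.2.1 (h1.1.eq_zero_of_sq_eq_zero h3.2.2.1)
  have h23 : CaseDoubleRoot g e → ¬CaseTwoStepNilpotent g e := fun ⟨μ, hμ, h2⟩ h3 => by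
    rw [rootMultiplicity_minpoly_of_sq_eq_zero h3.2.2.1 hμ] at h2
    omega
  tauto

/-- If `t = R(a,c,b,d)` vanishes, a Jordan block of `W⁺` belongs to the eigenvalue `-τ/12`, and
`W⁻` is a multiple of `τ`. -/
theorem type_of_jordanValues {g : ScalarProduct V} {a b c d a' b' c' d' : V} {k l p q r : ℝ}
    (h : HasReducedCurvature g a b c d k l 0 p q) {e : Module.Basis (Fin 4) ℝ V}
    (he : IsOrthonormalBasis g e) (ho : e.det ![a, b, c, d] = -1)
    (hf : IsNullFrame g a' b' c' d') (hr : r ≠ 0)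
    (hj : HasJordanValues (weylPlus g e) a' b' c' d' (scalarCurv g / 12) r) :
    CaseDoubleRoot g e ∨ CaseTwoStepNilpotent g e := by
  by_cases hκ : scalarCurv g / 12 = 0
  · right
    have hne := hj.ne_zero hf hr
    rw [hκ] at hj
    refine .of_weyl ?_ hne (hj.sq_eq_zero hf)
    ext1 α
    obtain ⟨w1, w2, w3, w4, w5, w6⟩ := h.weylMinus_values he ho α
    apply TwoForm.ext_nullFrame h.toIsNullFrame <;> simp [w1, w2, w3, w4, w5, w6, hκ]
  · exact Or.inl ⟨-(scalarCurv g / 12), neg_ne_zero.2 hκ, hj.double_root hf hκ hr⟩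

theorem type_of_reducedCurvature {g : ScalarProduct V} {a b c d : V} {k l t p q : ℝ}
    (h : HasReducedCurvature g a b c d k l t p q) {e : Module.Basis (Fin 4) ℝ V}
    (he : IsOrthonormalBasis g e) (ho : e.det ![a, b, c, d] = -1)
    (hpq : (p = 0 ∧ q = 0) ∨ (t = 0 ∧ (p = 0 ∨ q = 0))) :
    CaseDiagonalizable g e ∨ CaseDoubleRoot g e ∨ CaseTwoStepNilpotent g e := by
  have hf := h.toIsNullFrame
  have hplus := h.weylPlus_values he ho
  by_cases hd : p = 0 ∧ q = 0
  · left
    obtain ⟨rfl, rfl⟩ := hd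
    constructor
    · refine isDiagonalizable_of_values hf (x := scalarCurv g / 12 - t)
        (y := scalarCurv g / 12 - t) (r := -(scalarCurv g / 12 - t))
        (s := -(scalarCurv g / 12 - t)) (t := 0) (u := 0) fun α => ?_
      obtain ⟨w1, w2, w3, w4, w5, w6⟩ := hplus α
      exact ⟨by rw [w1]; ring, by rw [w2]; ring, by rw [w3]; ring, by rw [w4]; ring,
        by rw [w5]; ring, by rw [w6]; ring⟩
    · refine isDiagonalizable_of_values hf (x := scalarCurv g / 12)
        (y := -(scalarCurv g / 12)) (r := 0) (s := 0) (t := -(scalarCurv g / 12))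
        (u := -(scalarCurv g / 12)) fun α => ?_
      obtain ⟨w1, w2, w3, w4, w5, w6⟩ := h.weylMinus_values he ho α
      exact ⟨by rw [w1]; ring, by rw [w2]; ring, by rw [w3]; ring, by rw [w4]; ring,
        w5, w6⟩
  · right
    obtain ⟨rfl, hpq'⟩ := hpq.resolve_left hd
    simp only [sub_zero] at hplus
    by_cases hp : p = 0
    · subst hp
      refine type_of_jordanValues h he ho hf (fun hq => hd ⟨rfl, hq⟩)
        ⟨fun α => (hplus α).1, fun α => (hplus α).2.1, fun α => ?_,
          fun α => (hplus α).2.2.2.1, fun α => (hplus α).2.2.2.2.1, fun α => (hplus α).2.2.2.2.2⟩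
      rw [(hplus α).2.2.1]
      ring
    · obtain rfl := hpq'.resolve_left hp
      -- in the frame `b, a, d, c` the roles of `p` and `q` are exchanged
      refine type_of_jordanValues h he ho hf.swap hp ⟨fun α => ?_, fun α => ?_, fun α => ?_,
        fun α => (hplus α).2.2.1, fun α => (hplus α).2.2.2.2.2, fun α => (hplus α).2.2.2.2.1⟩
      · rw [TwoForm.skew _ b a, (hplus α).1, α.skew b a, α.skew d c]
        ring
      · rw [TwoForm.skew _ d c, (hplus α).2.1, α.skew b a, α.skew d c]
        ring
      · rw [(hplus α).2.2.2.1]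
        ring

/-- The statement for the Lie algebra of left-invariant vector fields. -/
theorem exactly_one_type {g : ScalarProduct V} {Jp Jm : V →ₗ[ℝ] V} {Ωp Ωm : TwoForm V}
    (hJp : IsAlmostParaKahler g Jp Ωp) (hJm : IsAlmostParaKahler g Jm Ωm)
    (hpair : IsSymplecticPair Ωp Ωm) (hparallel : IsParallel g Ωm)
    (hricci : ∀ X, ricciOp g (Jp X) = Jp (ricciOp g X))
    {e : Module.Basis (Fin 4) ℝ V} (he : IsOrthonormalBasis g e)
    (horient : hodgeStar g e Ωp = Ωp) :
    (CaseDiagonalizable g e ∧ ¬CaseDoubleRoot g e ∧ ¬CaseTwoStepNilpotent g e) ∨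
      (¬CaseDiagonalizable g e ∧ CaseDoubleRoot g e ∧ ¬CaseTwoStepNilpotent g e) ∨
      (¬CaseDiagonalizable g e ∧ ¬CaseDoubleRoot g e ∧ CaseTwoStepNilpotent g e) := by
  have hV : Module.finrank ℝ V = 4 := by simp [Module.finrank_eq_card_basis e]
  obtain ⟨a, b, c, d, h⟩ := exists_adaptedFrame hV hJp hJm hpair
  have hf := h.toIsNullFrame
  obtain ⟨α, β, γ, δ, hconn⟩ := h.exists_connection hJp hJm hparallel
  have Jskew : ∀ X Y, g.form (Jp X) Y = -g.form X (Jp Y) := fun X Y => by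
    have := hJp.anti_isometry X (Jp Y)
    rwa [hJp.sq] at this
  have hac : ricci g a c = 0 := by
    have h1 := congrArg (fun v => g.form v c) (hricci a)
    simp only [h.Jp_a, Jskew, h.Jp_c, form_ricciOp] at h1
    linarith
  have hbd : ricci g b d = 0 := by
    have h1 := congrArg (fun v => g.form v d) (hricci b)
    simp only [h.Jp_b, Jskew, h.Jp_d, form_ricciOp, map_neg, LinearMap.neg_apply] at h1
    linarith
  -- `Ω₊(a,b) = Ω₊(c,d) = 1`, so self-duality fixes the orientation of the frame
  have ho : e.det ![a, b, c, d] = -1 := by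
    have h1 := (hodgeStar_nullFrame he hf Ωp).1
    rw [horient, hJp.fundamental, hJp.fundamental, h.Jp_a, h.Jp_c, hf.ab, hf.cd] at h1
    linarith
  obtain ⟨k, l, t, p, q, hred, hpq⟩ := hconn.exists_reducedCurvature he hac hbd
  exact exactly_one_of_some (type_of_reducedCurvature hred he ho hpq)

end WeylType

end ParaLie

end

theorem mainTheorem6 {G : Type*} [TopologicalSpace G]
    [ChartedSpace (EuclideanSpace ℝ (Fin 4)) G] [Group G] [LieGroup (𝓡 4) ∞ G]
    (g : ParaLie.LeftInvariantMetric G) (Jp Jm : ParaLie.LeftInvariantEndo G)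
    (Ωp Ωm : ParaLie.TwoForm (ParaLie.LieAlg G))
    (hJp : ParaLie.IsAlmostParaKahler g.onLieAlg Jp.onLieAlg Ωp)
    (hJm : ParaLie.IsAlmostParaKahler g.onLieAlg Jm.onLieAlg Ωm)
    (hpair : ParaLie.IsSymplecticPair Ωp Ωm)
    (hparallel : ParaLie.IsParallel g.onLieAlg Ωm)
    (hricci : ∀ X, ParaLie.ricciOp g.onLieAlg (Jp.onLieAlg X) =
      Jp.onLieAlg (ParaLie.ricciOp g.onLieAlg X))
    (e : Module.Basis (Fin 4) ℝ (ParaLie.LieAlg G))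
    (he : ParaLie.IsOrthonormalBasis g.onLieAlg e)
    (horient : ParaLie.hodgeStar g.onLieAlg e Ωp = Ωp) :
    (ParaLie.CaseDiagonalizable g.onLieAlg e ∧
        ¬ ParaLie.CaseDoubleRoot g.onLieAlg e ∧
        ¬ ParaLie.CaseTwoStepNilpotent g.onLieAlg e) ∨
      (¬ ParaLie.CaseDiagonalizable g.onLieAlg e ∧
        ParaLie.CaseDoubleRoot g.onLieAlg e ∧
        ¬ ParaLie.CaseTwoStepNilpotent g.onLieAlg e) ∨
      (¬ ParaLie.CaseDiagonalizable g.onLieAlg e ∧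
        ¬ ParaLie.CaseDoubleRoot g.onLieAlg e ∧
        ParaLie.CaseTwoStepNilpotent g.onLieAlg e) := by
  exact ParaLie.exactly_one_type hJp hJm hpair hparallel hricci he horient
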